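/- Let $d\ge 0$ and $N\ge 1$, and let $A=\bigcap_{i=1}^N A_i$ and $B=\bigcap_{i=1}^N B_i$ be nonempty polyhedra in $\mathbb{R}^d$, where each $A_i$ and each $B_i$ is a closed half-space or all of $\mathbb{R}^d$. (Allowing $\mathbb{R}^d$ itself lets the two lists have the same length; $A$ and $B$ need not be disjoint.) Extend the lists cyclically, $A_{n+N}=A_n$ and $B_{n+N}=B_n$ for $n\ge 1$, and let $P_C$ denote the metric projection onto a closed convex set $C$. Let $(\lambda_n)_{n\ge 1}$ be numbers in $[0,1]$ with $\lambda_n\to 0$, $\sum_n\lambda_n=\infty$ and $\sum_n|\lambda_n-\lambda_{n+N}|<\infty$. For $a,b,x\in\mathbb{R}^d$ put $Q_{B,0}(a;x)=x$, $Q_{A,0}(b;x)=x$ and, for $n\ge 1$, $$Q_{B,n}(a;x)=\lambda_n a+(1-\lambda_n)P_{B_n}\bigl(Q_{B,n-1}(a;x)\bigr),\qquad Q_{A,n}(b;x)=\lambda_n b+(1-\lambda_n)P_{A_n}\bigl(Q_{A,n-1}(b;x)\bigr).$$ Let $(n_k)_{k\ge 0}$ be a nondecreasing sequence of nonnegative integers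 with $$n_k\to\infty\qquad\text{and}\qquad \sup_{k_0\ge 0}\ \sum_{k>k_0}\ \prod_{n=n_{k_0}+1}^{n_k}(1-\lambda_n)<\infty .$$ Let $a_0\in\mathbb{R}^d$ be arbitrary, let $(a'_{2k},b'_{2k+1})_{k\ge 0}$ be a bounded sequence of pairs of points of $\mathbb{R}^d$, and let, for $k\ge 0$, $$b_{2k+1}=Q_{B,n_{2k}}(a_{2k};a'_{2k}),\qquad a_{2k+2}=Q_{A,n_{2k+1}}(b_{2k+1};b'_{2k+1}).$$ Then the pairs $(a_{2k},b_{2k+1})$ converge to a best approximation pair relative to $(A,B)$, that is, to a pair $(a^*,b^*)\in A\times B$ with $|a^*-b^*|=\min\{|x-y| : x\in A,\ y\in B\}$. (The best approximation pair need not be unique.) -/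

import Mathlib

open Filter Topology

/-- A closed half-space of a real inner product space: `{x | ⟪u, x⟫ ≤ c}` with `u ≠ 0`. -/
def IsClosedHalfSpace {E : Type*} [NormedAddCommGroup E] [InnerProductSpace ℝ E]
    (S : Set E) : Prop :=
  ∃ (u : E) (c : ℝ), u ≠ 0 ∧ S = {x | inner ℝ u x ≤ c}

/-- `y` is a point of `C` nearest to `x`. -/
def IsNearestPoint {E : Type*} [NormedAddCommGroup E] (C : Set E) (x y : E) : Prop :=
  y ∈ C ∧ ∀ z ∈ C, ‖x - y‖ ≤ ‖x - z‖

open Classical in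
/-- The metric projection onto `C`: the point of `C` nearest to `x`. It exists and is unique when
`C` is nonempty, closed and convex; where there is no nearest point the value is `x`. -/
noncomputable def metricProj {E : Type*} [NormedAddCommGroup E] (C : Set E) (x : E) : E :=
  if h : ∃ y, IsNearestPoint C x y then h.choose else x

/-- In a Hilbert space, the metric projection onto a nonempty closed convex set is characterized
by being a nearest point. -/
theorem metricProj_eq_iff {E : Type*} [NormedAddCommGroup E] [InnerProductSpace ℝ E]
    [CompleteSpace E] {C : Set E} (hne : C.Nonempty) (hcl : IsClosed C) (hcv : Convex ℝ C)
    (x y : E) : metricProj C x = y ↔ IsNearestPoint C x y := by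
  have key : ∀ v, IsNearestPoint C x v → v ∈ C ∧ ∀ w ∈ C, inner ℝ (x - v) (w - v) ≤ 0 := by
    intro v hv
    refine ⟨hv.1, (norm_eq_iInf_iff_real_inner_le_zero hcv hv.1).1 ?_⟩
    have : Nonempty C := hne.to_subtype
    apply le_antisymm
    · exact le_ciInf fun w => hv.2 w w.2
    · exact ciInf_le ⟨0, by rintro _ ⟨w, rfl⟩; exact norm_nonneg _⟩ (⟨v, hv.1⟩ : C)
  have uniq : ∀ v w, IsNearestPoint C x v → IsNearestPoint C x w → v = w := by
    intro v w hv hw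
    have h1 := (key v hv).2 w hw.1
    have h2 := (key w hw).2 v hv.1
    have h3 : inner ℝ (v - w) (v - w) = inner ℝ (x - v) (w - v) + inner ℝ (x - w) (v - w) := by
      simp only [inner_sub_left, inner_sub_right]
      ring
    have h4 : inner ℝ (v - w) (v - w) = (0 : ℝ) :=
      le_antisymm (by linarith) real_inner_self_nonneg
    exact sub_eq_zero.1 (inner_self_eq_zero.1 h4)
  have ex : ∃ v, IsNearestPoint C x v := by
    obtain ⟨v, hv, hv'⟩ := exists_norm_eq_iInf_of_complete_convex hne hcl.isComplete hcv x
    refine ⟨v, hv, fun z hz => ?_⟩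
    rw [hv']
    exact ciInf_le ⟨0, by rintro _ ⟨w, rfl⟩; exact norm_nonneg _⟩ (⟨z, hz⟩ : C)
  have hp : IsNearestPoint C x (metricProj C x) := by
    unfold metricProj
    rw [dif_pos ex]
    exact ex.choose_spec
  exact ⟨fun h => h ▸ hp, fun h => uniq _ _ hp h⟩

/-- `n` steps of the HLWB iteration with anchor `a` and starting point `x`:
`Q₀ = x` and `Qₙ = λₙ a + (1 - λₙ) P_{Cₙ}(Qₙ₋₁)` for `n ≥ 1`, where `C₁, …, C_N` are the given sets
repeated cyclically. They are indexed here by `Fin N`, so that `C_{n+1}` is the set with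
index `n mod N`. -/
noncomputable def hlwb {E : Type*} [NormedAddCommGroup E] [NormedSpace ℝ E] {N : ℕ} [NeZero N]
    (lam : ℕ → ℝ) (C : Fin N → Set E) (a x : E) : ℕ → E
  | 0 => x
  | n + 1 => lam (n + 1) • a +
      (1 - lam (n + 1)) • metricProj (C (Fin.ofNat N n)) (hlwb lam C a x n)

/-- The sequences `a₀, a₂, a₄, …` and `b₁, b₃, b₅, …` are a run of the alternating HLWB algorithm
with sweep lengths `nk` and auxiliary starting points `a'₀, a'₂, …` and `b'₁, b'₃, …`: for even `k`,
`b_{k+1}` is obtained from `a_k` by `nk k` steps with the sets `B`; for odd `k`, `a_{k+1}` is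
obtained from `b_k` by `nk k` steps with the sets `A`. Only the even-indexed values of `a`, `a'` and
the odd-indexed values of `b`, `b'` matter. -/
def IsAlternatingHLWB {E : Type*} [NormedAddCommGroup E] [NormedSpace ℝ E] {N : ℕ} [NeZero N]
    (lam : ℕ → ℝ) (nk : ℕ → ℕ) (A B : Fin N → Set E) (a' b' a b : ℕ → E) : Prop :=
  (∀ k, Even k → b (k + 1) = hlwb lam B (a k) (a' k) (nk k)) ∧
  (∀ k, Odd k → a (k + 1) = hlwb lam A (b k) (b' k) (nk k))

/-- `p` is a best approximation pair relative to `(A, B)`: a pair in `A × B` whose distance is the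
minimum of `‖x - y‖` over `x ∈ A`, `y ∈ B`. -/
def IsBestApproxPair {E : Type*} [NormedAddCommGroup E] (A B : Set E) (p : E × E) : Prop :=
  p.1 ∈ A ∧ p.2 ∈ B ∧ ∀ x ∈ A, ∀ y ∈ B, ‖p.1 - p.2‖ ≤ ‖x - y‖

/-! One round trip of the algorithm is a_{2k+2} = R_k(a_{2k}), where R_k is a sweep over the B_i
followed by a sweep over the A_i. Each R_k is nonexpansive, and R_k → T = P_A P_B uniformly on
bounded sets, by the cyclic projection theorem `tendsto_hlwb` and compactness
(`uniform_tendsto_hlwb`). The fixed points of T are the first components of best approximation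
pairs. They exist because A and B are polyhedra (`exists_isBestApproxPair_of_polyhedra`), and T
brings every non-fixed point strictly closer to each of them (`altProj_sub_lt`).

The convergence R_k → T comes without a rate, so a bounded orbit approaches Fix T but might drift
along it. Polyhedrality excludes this. Let p be fixed, and let K be the orthogonal complement of the
normals of the A_i active at p and of the B_i active at P_B p. Near p, late projection steps move
only along these normals, so in K each step just multiplies the difference to the anchor by 1 - λ_n
(`exists_norm_starProjection_hlwb_sub_le`). Hence the K-component of R_k x - x is bounded by a
multiple of products of the 1 - λ_n, and these are summable over k by the hypothesis on the sweep
lengths.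

Fix T is stratified by the number of active constraints: a fixed point near p with at least as many
active constraints as p lies in p + K (`exists_ball_forall_inner_sub_eq_zero`). Take a cluster point
p of the orbit with the fewest. All cluster points near p then lie in p + K, so close to p the orbit
has vanishing component normal to K and summable motion inside K, and it is trapped
(`exists_tendsto_of_asymptotic_iteration`). Boundedness follows from the same trapping argument
around a point of Fix T with the fewest active constraints (`exists_bounded_orbit`). -/

/-! ### Projections onto closed convex sets -/

/-- A nonempty closed convex set. -/
structure IsNonemptyClosedConvex {X : Type*} [NormedAddCommGroup X] [InnerProductSpace ℝ X]
    (C : Set X) : Prop where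
  nonempty : C.Nonempty
  isClosed : IsClosed C
  convex : Convex ℝ C

namespace IsNonemptyClosedConvex

variable {X : Type*} [NormedAddCommGroup X] [InnerProductSpace ℝ X] [CompleteSpace X] {C : Set X}

theorem isNearestPoint (hC : IsNonemptyClosedConvex C) (x : X) :
    IsNearestPoint C x (metricProj C x) :=
  (metricProj_eq_iff hC.nonempty hC.isClosed hC.convex x _).1 rfl

theorem proj_mem (hC : IsNonemptyClosedConvex C) (x : X) : metricProj C x ∈ C :=
  (hC.isNearestPoint x).1

theorem inner_proj_le (hC : IsNonemptyClosedConvex C) (x : X) {w : X} (hw : w ∈ C) :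
    inner ℝ (x - metricProj C x) (w - metricProj C x) ≤ 0 := by
  have hv := hC.isNearestPoint x
  refine (norm_eq_iInf_iff_real_inner_le_zero hC.convex hv.1).1 ?_ w hw
  have : Nonempty C := hC.nonempty.to_subtype
  apply le_antisymm
  · exact le_ciInf fun w => hv.2 w w.2
  · exact ciInf_le ⟨0, by rintro _ ⟨w, rfl⟩; exact norm_nonneg _⟩ (⟨metricProj C x, hv.1⟩ : C)

theorem proj_eq_of_isNearestPoint (hC : IsNonemptyClosedConvex C) {x y : X}
    (h : IsNearestPoint C x y) : metricProj C x = y :=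
  (metricProj_eq_iff hC.nonempty hC.isClosed hC.convex x _).2 h

theorem proj_of_mem (hC : IsNonemptyClosedConvex C) {x : X} (hx : x ∈ C) : metricProj C x = x :=
  hC.proj_eq_of_isNearestPoint ⟨hx, fun z _ => by simp⟩

/-- The variational inequalities at the two projections add up to a nonnegative inner product of the
difference of projections with the difference of residuals. The residual term is kept because it
yields both the equality case and the vanishing of residuals along the iteration. -/
theorem proj_firm (hC : IsNonemptyClosedConvex C) (x y : X) :
    ‖metricProj C x - metricProj C y‖ ^ 2 +
      ‖(x - metricProj C x) - (y - metricProj C y)‖ ^ 2 ≤ ‖x - y‖ ^ 2 := by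
  have h1 := hC.inner_proj_le x (hC.proj_mem y)
  have h2 := hC.inner_proj_le y (hC.proj_mem x)
  set u := metricProj C x
  set v := metricProj C y
  have h3 : x - y = (u - v) + ((x - u) - (y - v)) := by abel
  have h4 := norm_add_sq_real (u - v) ((x - u) - (y - v))
  rw [← h3] at h4
  have h5 : inner ℝ (u - v) ((x - u) - (y - v)) =
      -inner ℝ (x - u) (v - u) - inner ℝ (y - v) (u - v) := by
    rw [inner_sub_right, real_inner_comm, real_inner_comm (y - v), ← neg_sub u v, inner_neg_right]
    ring
  linarith

theorem proj_lipschitz (hC : IsNonemptyClosedConvex C) (x y : X) :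
    ‖metricProj C x - metricProj C y‖ ≤ ‖x - y‖ := by
  have := hC.proj_firm x y
  refine (sq_le_sq₀ (norm_nonneg _) (norm_nonneg _)).1 ?_
  nlinarith [sq_nonneg ‖(x - metricProj C x) - (y - metricProj C y)‖]

theorem continuous_proj (hC : IsNonemptyClosedConvex C) : Continuous (metricProj C) := by
  refine (LipschitzWith.of_dist_le_mul (K := 1) fun x y => ?_).continuous
  simpa [dist_eq_norm] using hC.proj_lipschitz x y

/-- The residual of the projection is the same for two points whose distance the projection
preserves. -/
theorem sub_proj_eq_of_norm_le (hC : IsNonemptyClosedConvex C) {x y : X}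
    (h : ‖x - y‖ ≤ ‖metricProj C x - metricProj C y‖) :
    x - metricProj C x = y - metricProj C y := by
  have h1 := hC.proj_firm x y
  have h2 := pow_le_pow_left₀ (norm_nonneg _) h 2
  have h3 : ‖(x - metricProj C x) - (y - metricProj C y)‖ ^ 2 = 0 :=
    le_antisymm (by linarith) (sq_nonneg _)
  exact sub_eq_zero.1 (norm_eq_zero.1 (pow_eq_zero_iff two_ne_zero |>.1 h3))

theorem inner_sub_proj_eq_zero (hC : IsNonemptyClosedConvex C) (x : X) {l : X}
    (h1 : metricProj C x + l ∈ C) (h2 : metricProj C x - l ∈ C) :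
    inner ℝ (x - metricProj C x) l = 0 := by
  have h3 := hC.inner_proj_le x h1
  have h4 := hC.inner_proj_le x h2
  rw [add_sub_cancel_left] at h3
  rw [sub_sub_cancel_left, inner_neg_right] at h4
  linarith

end IsNonemptyClosedConvex

theorem IsNonemptyClosedConvex.iInter {X ι : Type*} [NormedAddCommGroup X]
    [InnerProductSpace ℝ X] {C : ι → Set X} (h : ∀ i, IsNonemptyClosedConvex (C i))
    (hne : (⋂ i, C i).Nonempty) : IsNonemptyClosedConvex (⋂ i, C i) :=
  ⟨hne, isClosed_iInter fun i => (h i).isClosed, convex_iInter fun i => (h i).convex⟩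

/-! ### Convergence of the HLWB iteration -/

/-- A sequence with `s (n + 1) ≤ (1 - μ n) s n + μ n β n + γ n` tends to zero if `∑ μ n = ∞`,
`limsup β n ≤ 0` and `γ` is summable. -/
theorem tendsto_zero_of_le_convex_recursion {s μ β γ : ℕ → ℝ} (hs : ∀ n, 0 ≤ s n)
    (hμ0 : ∀ n, 0 ≤ μ n) (hμ1 : ∀ n, μ n ≤ 1)
    (hμ : Tendsto (fun n => ∑ i ∈ Finset.range n, μ i) atTop atTop)
    (hβ : ∀ ε > 0, ∀ᶠ n in atTop, β n ≤ ε) (hγ0 : ∀ n, 0 ≤ γ n) (hγ : Summable γ)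
    (h : ∀ n, s (n + 1) ≤ (1 - μ n) * s n + μ n * β n + γ n) :
    Tendsto s atTop (𝓝 0) := by
  have key : ∀ ε > 0, ∀ᶠ n in atTop, s n ≤ 3 * ε := by
    intro ε hε
    obtain ⟨m₁, hm₁⟩ := eventually_atTop.1 (hβ ε hε)
    have htail := (tendsto_sum_nat_add γ).eventually (gt_mem_nhds hε)
    obtain ⟨m₂, hm₂⟩ := eventually_atTop.1 htail
    set m := max m₁ m₂
    have hγm : ∀ j, ∑ i ∈ Finset.range j, γ (i + m) ≤ ε := fun j =>
      (((summable_nat_add_iff m).2 hγ).sum_le_tsum _ fun i _ => hγ0 _).trans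
        (hm₂ m (le_max_right _ _)).le
    -- By 1 - μ ≤ exp(-μ), divergence of ∑ μ kills the initial value; beyond m, β and the tail of γ
    -- cost at most ε each.
    have hrec : ∀ j, s (m + j) ≤ ε + Real.exp (-∑ i ∈ Finset.range j, μ (m + i)) * s m +
        ∑ i ∈ Finset.range j, γ (i + m) := by
      intro j
      induction j with
      | zero => simp; linarith
      | succ j ih =>
        have h1 := h (m + j)
        have h2 := hm₁ (m + j) ((le_max_left _ _).trans (Nat.le_add_right _ _))
        have e1 : 1 - μ (m + j) ≤ Real.exp (-μ (m + j)) := by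
          have := Real.add_one_le_exp (-μ (m + j)); linarith
        have e0 := hμ0 (m + j)
        have e2 := hμ1 (m + j)
        rw [Finset.sum_range_succ, Finset.sum_range_succ, neg_add, Real.exp_add, ← add_assoc,
          add_comm j m]
        set S := ∑ i ∈ Finset.range j, γ (i + m)
        set x := Real.exp (-∑ i ∈ Finset.range j, μ (m + i))
        have hS : 0 ≤ S := Finset.sum_nonneg fun i _ => hγ0 _
        have hx : 0 ≤ x * s m := mul_nonneg (Real.exp_pos _).le (hs m)
        have h3 := mul_le_mul_of_nonneg_left ih (by linarith : 0 ≤ 1 - μ (m + j))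
        have h4 := mul_le_mul_of_nonneg_left h2 e0
        have h5 := mul_le_mul_of_nonneg_right e1 hx
        have h6 := mul_nonneg e0 hS
        nlinarith
    have hdiv : Tendsto (fun j => ∑ i ∈ Finset.range j, μ (m + i)) atTop atTop := by
      have h1 : Tendsto (fun j => ∑ i ∈ Finset.range (m + j), μ i) atTop atTop :=
        hμ.comp (tendsto_add_atTop_nat m |>.congr fun j => add_comm _ _)
      have h2 := tendsto_atTop_add_const_right _ (-∑ i ∈ Finset.range m, μ i) h1
      refine h2.congr fun j => ?_
      rw [Finset.sum_range_add]; ring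
    have hexp : Tendsto (fun j => Real.exp (-∑ i ∈ Finset.range j, μ (m + i)) * s m)
        atTop (𝓝 (0 * s m)) :=
      (Real.tendsto_exp_neg_atTop_nhds_zero.comp hdiv).mul_const _
    rw [zero_mul] at hexp
    obtain ⟨J, hJ⟩ := eventually_atTop.1 (hexp.eventually (gt_mem_nhds hε))
    refine eventually_atTop.2 ⟨m + J, fun n hn => ?_⟩
    obtain ⟨j, rfl⟩ := Nat.exists_eq_add_of_le ((Nat.le_add_right m J).trans hn)
    have := hJ j (by omega)
    linarith [hrec j, hγm j]
  refine Metric.tendsto_atTop.2 fun ε hε => ?_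
  obtain ⟨K, hK⟩ := eventually_atTop.1 (key (ε / 4) (by positivity))
  refine ⟨K, fun n hn => ?_⟩
  rw [Real.dist_eq, sub_zero, abs_of_nonneg (hs n)]
  linarith [hK n hn]

theorem MapClusterPt.eq_of_tendsto {α Y : Type*} [TopologicalSpace Y] [T2Space Y] {F : Filter α}
    {u : α → Y} {y z : Y} (h : MapClusterPt y F u) (hu : Tendsto u F (𝓝 z)) : y = z :=
  have : (𝓝 y ⊓ 𝓝 z).NeBot := NeBot.mono h (inf_le_inf_left _ hu)
  eq_of_nhds_neBot this

section Hlwb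

variable {X : Type*} [NormedAddCommGroup X] [InnerProductSpace ℝ X] [ProperSpace X] {N : ℕ}
  [NeZero N] {lam : ℕ → ℝ} {C : Fin N → Set X}

theorem norm_convexComb_le {X : Type*} [NormedAddCommGroup X] [NormedSpace ℝ X] {t r : ℝ}
    (h0 : 0 ≤ t) (h1 : t ≤ 1) {x y : X} (hx : ‖x‖ ≤ r) (hy : ‖y‖ ≤ r) :
    ‖t • x + (1 - t) • y‖ ≤ r := by
  refine (norm_add_le _ _).trans ?_
  rw [norm_smul, norm_smul, Real.norm_of_nonneg h0, Real.norm_of_nonneg (by linarith)]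
  nlinarith

/-- Each step is a convex combination of the anchor and a nonexpansive image of the iterate, so the
bound is joint in anchor and starting point. -/
theorem hlwb_sub_hlwb_le (hlam : ∀ n, 1 ≤ n → 0 ≤ lam n ∧ lam n ≤ 1)
    (hC : ∀ i, IsNonemptyClosedConvex (C i)) {a a' x x' : X} {r : ℝ} (ha : ‖a - a'‖ ≤ r)
    (hx : ‖x - x'‖ ≤ r) (n : ℕ) : ‖hlwb lam C a x n - hlwb lam C a' x' n‖ ≤ r := by
  induction n with
  | zero => exact hx
  | succ n ih =>
    obtain ⟨h0, h1⟩ := hlam (n + 1) (by omega)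
    have := norm_convexComb_le h0 h1 ha
      (((hC (Fin.ofNat N n)).proj_lipschitz (hlwb lam C a x n) (hlwb lam C a' x' n)).trans ih)
    convert this using 2
    simp only [hlwb, smul_sub]; abel

theorem hlwb_sub_le (hlam : ∀ n, 1 ≤ n → 0 ≤ lam n ∧ lam n ≤ 1)
    (hC : ∀ i, IsNonemptyClosedConvex (C i)) {a x z : X} (hz : ∀ i, z ∈ C i) {r : ℝ}
    (ha : ‖a - z‖ ≤ r) (hx : ‖x - z‖ ≤ r) (n : ℕ) : ‖hlwb lam C a x n - z‖ ≤ r := by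
  have hfix : ∀ n, hlwb lam C z z n = z := by
    intro n
    induction n with
    | zero => rfl
    | succ n ih => rw [hlwb, ih, (hC _).proj_of_mem (hz _), ← add_smul]; simp
  simpa [hfix] using hlwb_sub_hlwb_le hlam hC ha hx n

theorem Fin.ofNat_add_self (n : ℕ) : Fin.ofNat N (n + N) = Fin.ofNat N n := by
  ext; simp [Fin.ofNat]

/-- Points `N` steps apart in the iteration get close. -/
theorem tendsto_hlwb_add_sub_hlwb (hlam : ∀ n, 1 ≤ n → 0 ≤ lam n ∧ lam n ≤ 1)
    (hsum : Tendsto (fun m => ∑ n ∈ Finset.range m, lam (n + 1)) atTop atTop)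
    (hvar : Summable fun n => |lam (n + 1) - lam (n + 1 + N)|)
    (hC : ∀ i, IsNonemptyClosedConvex (C i)) (hne : (⋂ i, C i).Nonempty) (a x : X) :
    Tendsto (fun n => ‖hlwb lam C a x (n + N) - hlwb lam C a x n‖) atTop (𝓝 0) := by
  obtain ⟨z, hz⟩ := hne
  rw [Set.mem_iInter] at hz
  set r := max ‖a - z‖ ‖x - z‖
  have hb := hlwb_sub_le hlam hC hz (le_max_left _ _ : ‖a - z‖ ≤ r) (le_max_right _ _)
  have hr : 0 ≤ r := (norm_nonneg _).trans (le_max_left _ _)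
  -- Steps n + 1 and n + 1 + N project on the same set. They differ only in the coefficient λ, which
  -- multiplies a vector of norm at most 2r.
  refine tendsto_zero_of_le_convex_recursion (μ := fun n => lam (n + 1 + N)) (β := fun _ => 0)
    (γ := fun n => |lam (n + 1) - lam (n + 1 + N)| * (2 * r)) (fun n => norm_nonneg _)
    (fun n => (hlam _ (by omega)).1) (fun n => (hlam _ (by omega)).2) ?_
    (fun ε hε => Eventually.of_forall fun n => hε.le) (fun n => by positivity)
    (hvar.mul_right _) ?_
  · have h1 := hsum.comp (tendsto_add_atTop_nat N |>.congr fun j => add_comm _ _)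
    refine (tendsto_atTop_add_const_right _ (-∑ i ∈ Finset.range N, lam (i + 1)) h1).congr
      fun j => ?_
    simp only [Function.comp]
    rw [Finset.sum_range_add]
    have : ∀ i, N + i + 1 = i + 1 + N := fun i => by ring
    simp [this]
  · intro n
    obtain ⟨h0, h1⟩ := hlam (n + 1 + N) (by omega)
    have e : hlwb lam C a x (n + 1 + N) - hlwb lam C a x (n + 1) =
        (1 - lam (n + 1 + N)) • (metricProj (C (Fin.ofNat N n)) (hlwb lam C a x (n + N)) -
          metricProj (C (Fin.ofNat N n)) (hlwb lam C a x n)) -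
        (lam (n + 1) - lam (n + 1 + N)) •
          (a - metricProj (C (Fin.ofNat N n)) (hlwb lam C a x n)) := by
      have e1 : n + 1 + N = (n + N) + 1 := by ring
      rw [e1, hlwb, hlwb, Fin.ofNat_add_self]
      module
    rw [e]
    refine (norm_sub_le _ _).trans ?_
    rw [norm_smul, norm_smul, Real.norm_of_nonneg (by linarith), Real.norm_eq_abs]
    have h2 : ‖a - metricProj (C (Fin.ofNat N n)) (hlwb lam C a x n)‖ ≤ 2 * r := by
      have h3 := (hC (Fin.ofNat N n)).proj_lipschitz (hlwb lam C a x n) z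
      rw [(hC _).proj_of_mem (hz _)] at h3
      have h4 := norm_sub_le_norm_sub_add_norm_sub a z
        (metricProj (C (Fin.ofNat N n)) (hlwb lam C a x n))
      rw [norm_sub_rev z] at h4
      linarith [hb n, le_max_left ‖a - z‖ ‖x - z‖]
    have h3 := mul_le_mul_of_nonneg_left
      ((hC (Fin.ofNat N n)).proj_lipschitz (hlwb lam C a x (n + N)) (hlwb lam C a x n))
      (by linarith : 0 ≤ 1 - lam (n + 1 + N))
    have h4 := mul_le_mul_of_nonneg_left h2 (abs_nonneg (lam (n + 1) - lam (n + 1 + N)))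
    linarith

/-- The iterates get close to the next set to be projected on. -/
theorem tendsto_hlwb_sub_proj (hlam : ∀ n, 1 ≤ n → 0 ≤ lam n ∧ lam n ≤ 1)
    (hlim : Tendsto lam atTop (𝓝 0))
    (hsum : Tendsto (fun m => ∑ n ∈ Finset.range m, lam (n + 1)) atTop atTop)
    (hvar : Summable fun n => |lam (n + 1) - lam (n + 1 + N)|)
    (hC : ∀ i, IsNonemptyClosedConvex (C i)) (hne : (⋂ i, C i).Nonempty) (a x : X) :
    Tendsto (fun n => hlwb lam C a x n - metricProj (C (Fin.ofNat N n)) (hlwb lam C a x n))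
      atTop (𝓝 0) := by
  have hclose := tendsto_hlwb_add_sub_hlwb hlam hsum hvar hC hne a x
  obtain ⟨z, hz⟩ := hne
  rw [Set.mem_iInter] at hz
  set r := max ‖a - z‖ ‖x - z‖
  have hra : ‖a - z‖ ≤ r := le_max_left _ _
  have hb := hlwb_sub_le hlam hC hz hra (le_max_right _ _)
  have hr : 0 ≤ r := (norm_nonneg _).trans (le_max_left _ _)
  set q := hlwb lam C a x
  set D : ℕ → ℝ := fun n => ‖q n - metricProj (C (Fin.ofNat N n)) (q n)‖ ^ 2
  -- Firm nonexpansiveness bounds the squared residual by the decrease of the squared distance to z;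
  -- pulling toward the anchor costs O(λ). Over N steps the decrease telescopes, and it is small
  -- because iterates N steps apart are close.
  have hstep : ∀ n, D n ≤ ‖q n - z‖ ^ 2 - ‖q (n + 1) - z‖ ^ 2 + 4 * r ^ 2 * lam (n + 1) := by
    intro n
    obtain ⟨h0, h1⟩ := hlam (n + 1) (by omega)
    have h2 := (hC (Fin.ofNat N n)).proj_firm (q n) z
    rw [(hC _).proj_of_mem (hz _), sub_self, sub_zero] at h2
    have h3 : ‖q (n + 1) - z‖ ≤ lam (n + 1) * r +
        ‖metricProj (C (Fin.ofNat N n)) (q n) - z‖ := by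
      have e : q (n + 1) - z = lam (n + 1) • (a - z) +
          (1 - lam (n + 1)) • (metricProj (C (Fin.ofNat N n)) (q n) - z) := by
        simp only [q, hlwb]; module
      rw [e]
      refine (norm_add_le _ _).trans ?_
      rw [norm_smul, norm_smul, Real.norm_of_nonneg h0, Real.norm_of_nonneg (by linarith)]
      nlinarith [norm_nonneg (metricProj (C (Fin.ofNat N n)) (q n) - z)]
    have h4 : ‖metricProj (C (Fin.ofNat N n)) (q n) - z‖ ≤ r := by
      have h5 := (hC (Fin.ofNat N n)).proj_lipschitz (q n) z
      rw [(hC _).proj_of_mem (hz _)] at h5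
      exact h5.trans (hb n)
    set w := ‖metricProj (C (Fin.ofNat N n)) (q n) - z‖
    have hw : 0 ≤ w := norm_nonneg _
    have h6 : ‖q (n + 1) - z‖ ^ 2 ≤ (lam (n + 1) * r + w) ^ 2 :=
      pow_le_pow_left₀ (norm_nonneg _) h3 2
    have h7 : lam (n + 1) * lam (n + 1) ≤ lam (n + 1) := by nlinarith
    have h8 := mul_le_mul_of_nonneg_right h7 (sq_nonneg r)
    have h9 := mul_le_mul_of_nonneg_left h4 (mul_nonneg h0 hr)
    have h10 : 0 ≤ lam (n + 1) * r ^ 2 := by positivity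
    simp only [D]
    nlinarith
  have hsumD : ∀ n j, ∑ i ∈ Finset.range j, D (n + i) ≤ ‖q n - z‖ ^ 2 - ‖q (n + j) - z‖ ^ 2 +
      4 * r ^ 2 * ∑ i ∈ Finset.range j, lam (n + i + 1) := by
    intro n j
    induction j with
    | zero => simp
    | succ j ih =>
      rw [Finset.sum_range_succ, Finset.sum_range_succ, mul_add]
      have := hstep (n + j)
      rw [← add_assoc n j 1]; linarith
  have hD : ∀ n, D n ≤ 2 * r * ‖q (n + N) - q n‖ +
      4 * r ^ 2 * ∑ i ∈ Finset.range N, lam (n + i + 1) := by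
    intro n
    have h1 : D n ≤ ∑ i ∈ Finset.range N, D (n + i) :=
      Finset.single_le_sum (f := fun i => D (n + i)) (fun i _ => sq_nonneg _)
        (Finset.mem_range.2 (NeZero.pos N))
    have h2 : ‖q n - z‖ ≤ ‖q (n + N) - z‖ + ‖q (n + N) - q n‖ := by
      have := norm_sub_le_norm_sub_add_norm_sub (q n) (q (n + N)) z
      rw [norm_sub_rev (q n) (q (n + N))] at this
      linarith
    have h3 : ‖q n - z‖ ^ 2 - ‖q (n + N) - z‖ ^ 2 ≤ 2 * r * ‖q (n + N) - q n‖ := by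
      have e : ‖q n - z‖ ^ 2 - ‖q (n + N) - z‖ ^ 2 =
        (‖q n - z‖ - ‖q (n + N) - z‖) * (‖q n - z‖ + ‖q (n + N) - z‖) := by ring
      rw [e]
      calc _ ≤ ‖q (n + N) - q n‖ * (‖q n - z‖ + ‖q (n + N) - z‖) :=
            mul_le_mul_of_nonneg_right (by linarith) (by positivity)
        _ ≤ ‖q (n + N) - q n‖ * (r + r) := by gcongr <;> exact hb _
        _ = _ := by ring
    linarith [hsumD n N]
  have hlam0 : Tendsto (fun n => ∑ i ∈ Finset.range N, lam (n + i + 1)) atTop (𝓝 0) := by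
    have : Tendsto (fun n => ∑ i ∈ Finset.range N, lam (n + (i + 1))) atTop
        (𝓝 (∑ i ∈ Finset.range N, (0 : ℝ))) :=
      tendsto_finsetSum _ fun i _ => hlim.comp (tendsto_add_atTop_nat (i + 1))
    simpa [add_assoc] using this
  have hD0 : Tendsto D atTop (𝓝 0) := by
    refine squeeze_zero (fun n => sq_nonneg _) hD ?_
    simpa using (hclose.const_mul (2 * r)).add (hlam0.const_mul (4 * r ^ 2))
  have := hD0.sqrt
  rw [Real.sqrt_zero] at this
  refine tendsto_zero_iff_norm_tendsto_zero.2 (this.congr fun n => ?_)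
  simp only [D]
  rw [Real.sqrt_sq (norm_nonneg _)]

/-- Cluster points of the iteration lie in the intersection of the sets. -/
theorem mem_iInter_of_mapClusterPt_hlwb (hlam : ∀ n, 1 ≤ n → 0 ≤ lam n ∧ lam n ≤ 1)
    (hlim : Tendsto lam atTop (𝓝 0))
    (hsum : Tendsto (fun m => ∑ n ∈ Finset.range m, lam (n + 1)) atTop atTop)
    (hvar : Summable fun n => |lam (n + 1) - lam (n + 1 + N)|)
    (hC : ∀ i, IsNonemptyClosedConvex (C i)) (hne : (⋂ i, C i).Nonempty) (a x : X) {y : X}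
    (hy : MapClusterPt y atTop (hlwb lam C a x)) : y ∈ ⋂ i, C i := by
  have hproj := tendsto_hlwb_sub_proj hlam hlim hsum hvar hC hne a x
  obtain ⟨z, hz⟩ := hne
  rw [Set.mem_iInter] at hz
  set r := max ‖a - z‖ ‖x - z‖
  have hb := hlwb_sub_le hlam hC hz (le_max_left _ _ : ‖a - z‖ ≤ r) (le_max_right _ _)
  set q := hlwb lam C a x
  have hstep : Tendsto (fun n => q (n + 1) - q n) atTop (𝓝 0) := by
    have h1 : ∀ n, q (n + 1) - q n = lam (n + 1) • (a - q n) -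
        (1 - lam (n + 1)) • (q n - metricProj (C (Fin.ofNat N n)) (q n)) := by
      intro n; simp only [q, hlwb]; module
    have hl1 : Tendsto (fun n => lam (n + 1)) atTop (𝓝 0) :=
      hlim.comp (tendsto_add_atTop_nat 1)
    have h2 : Tendsto (fun n => lam (n + 1) • (a - q n)) atTop (𝓝 0) := by
      refine hl1.zero_smul_isBoundedUnder_le ?_
      refine isBoundedUnder_of ⟨‖a - z‖ + r, fun n => ?_⟩
      have := norm_sub_le_norm_sub_add_norm_sub a z (q n)
      rw [norm_sub_rev z] at this
      exact this.trans (by linarith [hb n])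
    have h3 := h2.sub ((hl1.const_sub 1).smul hproj)
    simp only [smul_zero, sub_zero] at h3
    exact h3.congr fun n => (h1 n).symm
  have hsteps : ∀ j, Tendsto (fun n => q (n + j) - q n) atTop (𝓝 0) := by
    intro j
    induction j with
    | zero => simp
    | succ j ih =>
      have := (hstep.comp (tendsto_add_atTop_nat j)).add ih
      rw [add_zero] at this
      refine this.congr fun n => ?_
      simp only [Function.comp]
      rw [← add_assoc]; abel
  -- Any N consecutive steps visit every set, and consecutive iterates get close, so the residual
  -- vanishes for each set along the whole sequence.
  have hall : ∀ i : Fin N, Tendsto (fun n => q n - metricProj (C i) (q n)) atTop (𝓝 0) := by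
    intro i
    refine squeeze_zero_norm (a := fun n => ∑ j ∈ Finset.range N, (2 * ‖q (n + j) - q n‖ +
      ‖q (n + j) - metricProj (C (Fin.ofNat N (n + j))) (q (n + j))‖)) (fun n => ?_) ?_
    · obtain ⟨j, hj, hji⟩ : ∃ j < N, Fin.ofNat N (n + j) = i := by
        refine ⟨(i.val + (N - n % N)) % N, Nat.mod_lt _ (NeZero.pos N), ?_⟩
        ext
        simp only [Fin.ofNat, Nat.add_mod_mod]
        have h1 : n % N < N := Nat.mod_lt _ (NeZero.pos N)
        rw [Nat.add_mod, Nat.add_mod i.val]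
        have h2 : n + (i.val + (N - n % N)) = i.val + N * (n / N + 1) := by
          have := Nat.div_add_mod n N
          rw [mul_add, mul_one]
          omega
        rw [← Nat.add_mod i.val, ← Nat.add_mod, h2, Nat.add_mul_mod_self_left,
          Nat.mod_eq_of_lt i.isLt]
      refine le_trans ?_ (Finset.single_le_sum (f := fun j => (2 * ‖q (n + j) - q n‖ +
        ‖q (n + j) - metricProj (C (Fin.ofNat N (n + j))) (q (n + j))‖))
        (fun j _ => by positivity) (Finset.mem_range.2 hj))
      simp only [hji]
      have e : q n - metricProj (C i) (q n) = -(q (n + j) - q n) +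
          (q (n + j) - metricProj (C i) (q (n + j))) +
          (metricProj (C i) (q (n + j)) - metricProj (C i) (q n)) := by abel
      rw [e]
      refine (norm_add₃_le).trans ?_
      rw [norm_neg]
      linarith [(hC i).proj_lipschitz (q (n + j)) (q n)]
    · have : Tendsto (fun n => ∑ j ∈ Finset.range N, (2 * ‖q (n + j) - q n‖ +
          ‖q (n + j) - metricProj (C (Fin.ofNat N (n + j))) (q (n + j))‖)) atTop
          (𝓝 (∑ j ∈ Finset.range N, (2 * ‖(0 : X)‖ + ‖(0 : X)‖))) :=
        tendsto_finsetSum _ fun j _ => ((hsteps j).norm.const_mul 2).add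
          (hproj.comp (tendsto_add_atTop_nat j)).norm
      simpa using this
  rw [Set.mem_iInter]
  intro i
  have hcont : Continuous fun y => y - metricProj (C i) y :=
    continuous_id.sub (hC i).continuous_proj
  have h1 : MapClusterPt (y - metricProj (C i) y) atTop
      (fun n => q n - metricProj (C i) (q n)) :=
    hy.continuousAt_comp hcont.continuousAt
  have h2 : y - metricProj (C i) y = 0 := h1.eq_of_tendsto (hall i)
  rw [sub_eq_zero.1 h2]
  exact (hC i).proj_mem y

/-- The Halpern–Lions–Wittmann–Bauschke theorem for cyclic projections in a finite-dimensional
space. -/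
theorem tendsto_hlwb (hlam : ∀ n, 1 ≤ n → 0 ≤ lam n ∧ lam n ≤ 1)
    (hlim : Tendsto lam atTop (𝓝 0))
    (hsum : Tendsto (fun m => ∑ n ∈ Finset.range m, lam (n + 1)) atTop atTop)
    (hvar : Summable fun n => |lam (n + 1) - lam (n + 1 + N)|)
    (hC : ∀ i, IsNonemptyClosedConvex (C i)) (hne : (⋂ i, C i).Nonempty) (a x : X) :
    Tendsto (hlwb lam C a x) atTop (𝓝 (metricProj (⋂ i, C i) a)) := by
  have hcl := fun y => mem_iInter_of_mapClusterPt_hlwb hlam hlim hsum hvar hC hne a x (y := y)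
  have hI := IsNonemptyClosedConvex.iInter hC hne
  set z := metricProj (⋂ i, C i) a
  have hz : ∀ i, z ∈ C i := Set.mem_iInter.1 (hI.proj_mem a)
  set r := max ‖a - z‖ ‖x - z‖
  have hb := hlwb_sub_le hlam hC hz (le_max_left _ _ : ‖a - z‖ ≤ r) (le_max_right _ _)
  set q := hlwb lam C a x
  -- Otherwise a cluster point, which lies in the intersection, would violate the variational
  -- inequality for z.
  have hinner : ∀ ε > 0, ∀ᶠ n in atTop, inner ℝ (a - z) (q n - z) ≤ ε := by
    intro ε hε
    by_contra hcon
    have hfr : ∃ᶠ n in atTop, q n ∈ Metric.closedBall z r ∩ {y | ε ≤ inner ℝ (a - z) (y - z)} :=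
      (not_eventually.1 hcon).mono fun n hn =>
        ⟨mem_closedBall_iff_norm.2 (hb n), (not_le.1 hn).le⟩
    have hK : IsCompact (Metric.closedBall z r ∩ {y | ε ≤ inner ℝ (a - z) (y - z)}) :=
      (isCompact_closedBall z r).inter_right (isClosed_le continuous_const (by fun_prop))
    obtain ⟨y, hy, hyc⟩ := hK.exists_mapClusterPt_of_frequently hfr
    have h1 := hI.inner_proj_le a (hcl y hyc)
    have h2 : ε ≤ inner ℝ (a - z) (y - z) := hy.2
    exact absurd (h2.trans h1) (not_le.2 hε)
  have hsq : Tendsto (fun n => ‖q n - z‖ ^ 2) atTop (𝓝 0) := by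
    -- Halpern's estimate: ‖q_{n+1} - z‖² ≤ (1 - λ)‖q_n - z‖² + 2λ⟪a - z, q_{n+1} - z⟫.
    refine tendsto_zero_of_le_convex_recursion (μ := fun n => lam (n + 1))
      (β := fun n => 2 * inner ℝ (a - z) (q (n + 1) - z)) (γ := fun _ => 0)
      (fun n => sq_nonneg _) (fun n => (hlam _ (by omega)).1) (fun n => (hlam _ (by omega)).2) hsum
      ?_ (fun _ => le_rfl) summable_zero ?_
    · intro ε hε
      have := (tendsto_add_atTop_nat 1).eventually (hinner (ε / 2) (by positivity))
      exact this.mono fun n hn => by linarith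
    · intro n
      obtain ⟨h0, h1⟩ := hlam (n + 1) (by omega)
      set p := metricProj (C (Fin.ofNat N n)) (q n)
      have h3 : ‖p - z‖ ≤ ‖q n - z‖ := by
        have h5 := (hC (Fin.ofNat N n)).proj_lipschitz (q n) z
        rwa [(hC _).proj_of_mem (hz _)] at h5
      have e : q (n + 1) - z = lam (n + 1) • (a - z) + (1 - lam (n + 1)) • (p - z) := by
        simp only [q, p, hlwb]; module
      have h6 := norm_add_sq_real (lam (n + 1) • (a - z)) ((1 - lam (n + 1)) • (p - z))
      have h7 : inner ℝ (lam (n + 1) • (a - z)) ((1 - lam (n + 1)) • (p - z)) =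
          lam (n + 1) * inner ℝ (a - z) (q (n + 1) - z) - ‖lam (n + 1) • (a - z)‖ ^ 2 := by
        have : (1 - lam (n + 1)) • (p - z) = (q (n + 1) - z) - lam (n + 1) • (a - z) := by
          rw [e]; abel
        rw [this, inner_sub_right, real_inner_self_eq_norm_sq, real_inner_smul_left]
      rw [← e, h7, norm_smul (1 - lam (n + 1)), Real.norm_of_nonneg (by linarith)] at h6
      have h8 : ((1 - lam (n + 1)) * ‖p - z‖) ^ 2 ≤ (1 - lam (n + 1)) * ‖q n - z‖ ^ 2 := by
        rw [mul_pow]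
        have h9 := pow_le_pow_left₀ (norm_nonneg _) h3 2
        have h10 : (1 - lam (n + 1)) ^ 2 ≤ 1 - lam (n + 1) := by nlinarith
        exact mul_le_mul h10 h9 (sq_nonneg _) (by linarith)
      nlinarith [sq_nonneg ‖lam (n + 1) • (a - z)‖]
  have := hsq.sqrt
  rw [Real.sqrt_zero] at this
  refine tendsto_iff_norm_sub_tendsto_zero.2 (this.congr fun n => ?_)
  rw [Real.sqrt_sq (norm_nonneg _)]

/-- The convergence of the iteration is uniform for anchors and starting points in a bounded
set. -/
theorem uniform_tendsto_hlwb (hlam : ∀ n, 1 ≤ n → 0 ≤ lam n ∧ lam n ≤ 1)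
    (hlim : Tendsto lam atTop (𝓝 0))
    (hsum : Tendsto (fun m => ∑ n ∈ Finset.range m, lam (n + 1)) atTop atTop)
    (hvar : Summable fun n => |lam (n + 1) - lam (n + 1 + N)|)
    (hC : ∀ i, IsNonemptyClosedConvex (C i)) (hne : (⋂ i, C i).Nonempty) (R : ℝ) {ε : ℝ}
    (hε : 0 < ε) : ∀ᶠ n in atTop, ∀ a x : X, ‖a‖ ≤ R → ‖x‖ ≤ R →
      ‖hlwb lam C a x n - metricProj (⋂ i, C i) a‖ ≤ ε := by
  have hI := IsNonemptyClosedConvex.iInter hC hne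
  have hK : IsCompact (Metric.closedBall (0 : X × X) R) := isCompact_closedBall _ _
  -- Pointwise convergence on a finite ε/3-net of pairs (anchor, start) suffices, since the
  -- iteration is nonexpansive in the pair.
  obtain ⟨t, -, ht⟩ := hK.elim_finite_subcover_image (b := Set.univ)
    (c := fun p : X × X => Metric.ball p (ε / 3)) (fun _ _ => Metric.isOpen_ball)
    (fun p _ => Set.mem_biUnion (Set.mem_univ p) (Metric.mem_ball_self (by positivity)))
  obtain ⟨htf, ht⟩ := ht
  have hev : ∀ᶠ n in atTop, ∀ p ∈ t,
      ‖hlwb lam C p.1 p.2 n - metricProj (⋂ i, C i) p.1‖ < ε / 3 := by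
    rw [eventually_all_finite htf]
    intro p _
    have := tendsto_iff_norm_sub_tendsto_zero.1
      (tendsto_hlwb hlam hlim hsum hvar hC hne p.1 p.2)
    exact this.eventually (gt_mem_nhds (by positivity))
  filter_upwards [hev] with n hn a x ha hx
  have hax : (a, x) ∈ Metric.closedBall (0 : X × X) R := by
    rw [mem_closedBall_zero_iff, Prod.norm_def]; exact max_le ha hx
  obtain ⟨p, hp, hpb⟩ := Set.mem_iUnion₂.1 (ht hax)
  rw [mem_ball_iff_norm, Prod.norm_def] at hpb
  have h1 : ‖a - p.1‖ ≤ ε / 3 := (le_max_left _ _).trans hpb.le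
  have h2 : ‖x - p.2‖ ≤ ε / 3 := (le_max_right _ _).trans hpb.le
  have h3 := hlwb_sub_hlwb_le hlam hC h1 h2 n
  have h4 := hI.proj_lipschitz p.1 a
  rw [norm_sub_rev p.1] at h4
  have e : hlwb lam C a x n - metricProj (⋂ i, C i) a =
    (hlwb lam C a x n - hlwb lam C p.1 p.2 n) +
    (hlwb lam C p.1 p.2 n - metricProj (⋂ i, C i) p.1) +
    (metricProj (⋂ i, C i) p.1 - metricProj (⋂ i, C i) a) := by abel
  rw [e]
  refine norm_add₃_le.trans ?_
  linarith [hn p hp]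

end Hlwb

/-! ### Existence of best approximation pairs of polyhedra -/

/-- The norm of a linear image attains its minimum on a nonempty polyhedron. -/
theorem exists_forall_norm_map_le_of_polyhedron {ι Y Z : Type*} [Finite ι] [NormedAddCommGroup Y]
    [InnerProductSpace ℝ Y] [ProperSpace Y] [NormedAddCommGroup Z] [NormedSpace ℝ Z]
    (f : ι → Y →L[ℝ] ℝ) (c : ι → ℝ) (M : Y →L[ℝ] Z) (hne : ∃ z, ∀ i, f i z ≤ c i) :
    ∃ z, (∀ i, f i z ≤ c i) ∧ ∀ y, (∀ i, f i y ≤ c i) → ‖M z‖ ≤ ‖M y‖ := by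
  set P : Set Y := {z | ∀ i, f i z ≤ c i}
  set m : ℝ := sInf ((fun z => ‖M z‖) '' P)
  have hbdd : BddBelow ((fun z => ‖M z‖) '' P) := ⟨0, by rintro _ ⟨z, -, rfl⟩; positivity⟩
  have hm : ∀ y ∈ P, m ≤ ‖M y‖ := fun y hy => csInf_le hbdd ⟨y, hy, rfl⟩
  have hPcl : IsClosed P := by
    simp only [P, Set.ofPred_forall]
    exact isClosed_iInter fun i => isClosed_le (f i).continuous continuous_const
  have hPcv : Convex ℝ P := by
    simp only [P, Set.ofPred_forall]
    exact convex_iInter fun i => convex_halfSpace_le (f i).toLinearMap.isLinear _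
  set S : ℕ → Set Y := fun n => P ∩ {z | ‖M z‖ ≤ m + 1 / ((n : ℝ) + 1)}
  have hS : ∀ n, IsNonemptyClosedConvex (S n) := by
    intro n
    refine ⟨?_, hPcl.inter (isClosed_le (by fun_prop) continuous_const), hPcv.inter ?_⟩
    · obtain ⟨_, ⟨z, hz, rfl⟩, hzlt⟩ := exists_lt_of_csInf_lt (Set.Nonempty.image _ hne)
        (lt_add_of_pos_right m (Nat.one_div_pos_of_nat (α := ℝ) (n := n)))
      exact ⟨z, hz, hzlt.le⟩
    · have h1 : ConvexOn ℝ Set.univ fun z => ‖M z‖ :=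
        convexOn_univ_norm.comp_linearMap M.toLinearMap
      simpa using h1.convex_le (m + 1 / ((n : ℝ) + 1))
  set z : ℕ → Y := fun n => metricProj (S n) 0
  have hzS : ∀ n, z n ∈ S n := fun n => (hS n).proj_mem 0
  have hzmin : ∀ n, ∀ y ∈ S n, ‖z n‖ ≤ ‖y‖ := by
    intro n y hy
    simpa using ((hS n).isNearestPoint 0).2 y hy
  -- The z n are least-norm near-minimizers. If their norms tend to infinity, a limit direction w
  -- satisfies M w = 0 and f i w ≤ 0, and z n - w is a shorter near-minimizer for some n. Otherwise
  -- a cluster point is a minimizer.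
  by_cases hinf : Tendsto (fun n => ‖z n‖) atTop atTop
  · exfalso
    obtain ⟨w, -, φ, hφ, hw⟩ := (isCompact_closedBall (0 : Y) 1).tendsto_subseq
      (x := fun n => ‖z n‖⁻¹ • z n) (fun n => by
        rw [mem_closedBall_zero_iff, norm_smul, norm_inv, norm_norm]
        exact inv_mul_le_one)
    have hinf' : Tendsto (fun n => ‖z (φ n)‖) atTop atTop := hinf.comp hφ.tendsto_atTop
    have hpos : ∀ᶠ n in atTop, 0 < ‖z (φ n)‖ := hinf'.eventually_gt_atTop 0
    have hw1 : ‖w‖ = 1 := by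
      refine tendsto_nhds_unique hw.norm (tendsto_const_nhds.congr' ?_)
      filter_upwards [hpos] with n hn
      simp only [Function.comp]
      rw [norm_smul, norm_inv, norm_norm, inv_mul_cancel₀ hn.ne']
    have hMw : M w = 0 := by
      refine tendsto_nhds_unique ((M.continuous.tendsto w).comp hw) ?_
      refine squeeze_zero_norm (a := fun n => ‖z (φ n)‖⁻¹ * (m + 1)) (fun n => ?_) ?_
      · simp only [Function.comp, map_smul]
        rw [norm_smul, norm_inv, norm_norm]
        refine mul_le_mul_of_nonneg_left ?_ (by positivity)
        have h1 : ‖M (z (φ n))‖ ≤ m + 1 / ((φ n : ℝ) + 1) := (hzS (φ n)).2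
        have h2 : 1 / ((φ n : ℝ) + 1) ≤ 1 := by
          rw [div_le_one (by positivity)]
          linarith [(φ n).cast_nonneg (α := ℝ)]
        linarith
      · simpa using hinf'.inv_tendsto_atTop.mul_const (m + 1)
    have hfw : ∀ i, Tendsto (fun n => ‖z (φ n)‖⁻¹ * f i (z (φ n))) atTop (𝓝 (f i w)) := by
      intro i
      refine (((f i).continuous.tendsto w).comp hw).congr fun n => ?_
      simp
    -- Finitely many linear constraints are essential here: if f i w < 0, then f i (z (φ n)) → -∞
    -- leaves room for subtracting w; if f i w = 0, nothing changes.
    have hrec : ∀ i, ∀ᶠ n in atTop, f i (z (φ n) - w) ≤ c i := by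
      intro i
      have hle : f i w ≤ 0 := by
        have h1 : Tendsto (fun n => ‖z (φ n)‖⁻¹ * c i) atTop (𝓝 0) := by
          simpa using hinf'.inv_tendsto_atTop.mul_const (c i)
        refine le_of_tendsto_of_tendsto' (hfw i) h1 fun n => ?_
        exact mul_le_mul_of_nonneg_left ((hzS (φ n)).1 i) (by positivity)
      rcases hle.lt_or_eq with hlt | heq
      · have h1 := hinf'.atTop_mul_neg hlt (hfw i)
        filter_upwards [h1.eventually_le_atBot (c i + f i w), hpos] with n hn hn0
        rw [mul_inv_cancel_left₀ hn0.ne'] at hn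
        rw [map_sub]; linarith
      · refine Eventually.of_forall fun n => ?_
        rw [map_sub, heq, sub_zero]
        exact (hzS (φ n)).1 i
    have hinner : Tendsto (fun n => inner ℝ (z (φ n)) w) atTop atTop := by
      have h1 : Tendsto (fun n => inner ℝ (‖z (φ n)‖⁻¹ • z (φ n)) w) atTop (𝓝 (inner ℝ w w)) :=
        hw.inner tendsto_const_nhds
      rw [real_inner_self_eq_norm_sq, hw1, one_pow] at h1
      refine (hinf'.atTop_mul_pos one_pos h1).congr' ?_
      filter_upwards [hpos] with n hn
      rw [real_inner_smul_left, mul_inv_cancel_left₀ hn.ne']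
    obtain ⟨n, hn1, hn2⟩ := ((eventually_all.2 hrec).and (hinner.eventually_gt_atTop 1)).exists
    have hmem : z (φ n) - w ∈ S (φ n) := by
      refine ⟨hn1, ?_⟩
      change ‖M (z (φ n) - w)‖ ≤ _
      rw [map_sub, hMw, sub_zero]
      exact (hzS (φ n)).2
    have h1 := pow_le_pow_left₀ (norm_nonneg _) (hzmin _ _ hmem) 2
    rw [norm_sub_sq_real, hw1] at h1
    linarith
  · obtain ⟨R, hR⟩ : ∃ R, ∃ᶠ n in atTop, ‖z n‖ ≤ R := by
      by_contra hcon
      push Not at hcon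
      exact hinf (tendsto_atTop.2 fun R => (hcon R).mono fun n hn => hn.le)
    obtain ⟨y, -, hy⟩ := (isCompact_closedBall (0 : Y) R).exists_mapClusterPt_of_frequently
      (hR.mono fun n hn => mem_closedBall_zero_iff.2 hn)
    have hyP : y ∈ P := hPcl.mem_of_mapClusterPt hy (Eventually.of_forall fun n => (hzS n).1)
    refine ⟨y, hyP, fun x hx => (le_of_forall_pos_le_add fun ε hε => ?_ : ‖M y‖ ≤ m).trans
      (hm x hx)⟩
    by_contra hcon
    have h1 : ∀ᶠ x in 𝓝 y, m + ε < ‖M x‖ :=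
      (M.continuous.norm.tendsto y).eventually (lt_mem_nhds (not_le.1 hcon))
    have h2 := tendsto_one_div_add_atTop_nhds_zero_nat (𝕜 := ℝ) |>.eventually (gt_mem_nhds hε)
    obtain ⟨n, hn1, hn2⟩ := ((hy.frequently h1).and_eventually h2).exists
    have h3 : ‖M (z n)‖ ≤ m + 1 / ((n : ℝ) + 1) := (hzS n).2
    linarith

/-- Two nonempty polyhedra have a best approximation pair. -/
theorem exists_isBestApproxPair_of_polyhedra {ι κ X : Type*} [Finite ι] [Finite κ]
    [NormedAddCommGroup X] [InnerProductSpace ℝ X] [FiniteDimensional ℝ X]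
    (u : ι → X) (c : ι → ℝ) (v : κ → X) (e : κ → ℝ)
    (hA : (⋂ i, {x | inner ℝ (u i) x ≤ c i}).Nonempty)
    (hB : (⋂ i, {x | inner ℝ (v i) x ≤ e i}).Nonempty) :
    ∃ p, IsBestApproxPair (⋂ i, {x | inner ℝ (u i) x ≤ c i}) (⋂ i, {x | inner ℝ (v i) x ≤ e i})
      p := by
  obtain ⟨a, ha⟩ := hA
  obtain ⟨b, hb⟩ := hB
  simp only [Set.mem_iInter, Set.mem_ofPred_eq] at ha hb
  obtain ⟨z, hz, hmin⟩ := exists_forall_norm_map_le_of_polyhedron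
    (Y := WithLp 2 (X × X))
    (Sum.elim (fun i => (innerSL ℝ (u i)).comp (WithLp.fstL 2 ℝ X X))
      (fun i => (innerSL ℝ (v i)).comp (WithLp.sndL 2 ℝ X X)))
    (Sum.elim c e) (WithLp.fstL 2 ℝ X X - WithLp.sndL 2 ℝ X X)
    ⟨WithLp.toLp 2 (a, b), by rintro (i | i) <;> simp [ha, hb]⟩
  refine ⟨(z.fst, z.snd), ?_, ?_, fun x hx y hy => ?_⟩
  · simpa using fun i => hz (Sum.inl i)
  · simpa using fun i => hz (Sum.inr i)
  · simp only [Set.mem_iInter, Set.mem_ofPred_eq] at hx hy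
    simpa using hmin (WithLp.toLp 2 (x, y)) (by rintro (i | i) <;> simp [hx, hy])

/-! ### Fixed points of the alternating projection -/

section BestApproxPair

variable {X : Type*} [NormedAddCommGroup X] [InnerProductSpace ℝ X] [CompleteSpace X]
  {A B : Set X}

theorem IsBestApproxPair.proj_eq (hA : IsNonemptyClosedConvex A) (hB : IsNonemptyClosedConvex B)
    {p q : X} (h : IsBestApproxPair A B (p, q)) : metricProj B p = q ∧ metricProj A q = p := by
  refine ⟨hB.proj_eq_of_isNearestPoint ⟨h.2.1, fun y hy => h.2.2 p h.1 y hy⟩,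
    hA.proj_eq_of_isNearestPoint ⟨h.1, fun x hx => ?_⟩⟩
  rw [norm_sub_rev, norm_sub_rev q]
  exact h.2.2 x hx q h.2.1

theorem isBestApproxPair_of_fixed (hA : IsNonemptyClosedConvex A) (hB : IsNonemptyClosedConvex B)
    {p : X} (h : metricProj A (metricProj B p) = p) :
    IsBestApproxPair A B (p, metricProj B p) := by
  have hp : p ∈ A := h ▸ hA.proj_mem _
  refine ⟨hp, hB.proj_mem p, fun x hx y hy => ?_⟩
  have h1 := hB.inner_proj_le p hy
  have h2 := hA.inner_proj_le (metricProj B p) hx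
  rw [h] at h2
  set q := metricProj B p
  -- The last two terms are nonpositive by the variational inequalities at q and p; Cauchy–Schwarz
  -- handles the first.
  have h3 : ‖p - q‖ ^ 2 = inner ℝ (p - q) (x - y) + inner ℝ (p - q) (y - q) +
      inner ℝ (q - p) (x - p) := by
    rw [← real_inner_self_eq_norm_sq, ← neg_sub p q, inner_neg_left, ← inner_add_right,
      ← sub_eq_add_neg, ← inner_sub_right]
    congr 1; abel
  have h4 := real_inner_le_norm (p - q) (x - y)
  change ‖p - q‖ ≤ ‖x - y‖
  by_contra hcon
  push Not at hcon
  nlinarith [norm_nonneg (x - y), norm_nonneg (p - q)]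

theorem altProj_lipschitz (hA : IsNonemptyClosedConvex A) (hB : IsNonemptyClosedConvex B)
    (x y : X) : ‖metricProj A (metricProj B x) - metricProj A (metricProj B y)‖ ≤ ‖x - y‖ :=
  (hA.proj_lipschitz _ _).trans (hB.proj_lipschitz _ _)

/-- Without strict decrease both projections preserve the distance, so x and e have the same
residuals in both. These sum to zero for the fixed point e, hence also for x. -/
theorem altProj_sub_lt (hA : IsNonemptyClosedConvex A) (hB : IsNonemptyClosedConvex B) {x e : X}
    (he : metricProj A (metricProj B e) = e) (hx : metricProj A (metricProj B x) ≠ x) :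
    ‖metricProj A (metricProj B x) - e‖ < ‖x - e‖ := by
  by_contra hcon
  push Not at hcon
  have h1 := hA.proj_lipschitz (metricProj B x) (metricProj B e)
  have h2 := hB.proj_lipschitz x e
  rw [he] at h1
  have h3 := hB.sub_proj_eq_of_norm_le (hcon.trans h1)
  have h4 := hA.sub_proj_eq_of_norm_le (x := metricProj B x) (y := metricProj B e)
    (by rw [he]; exact h2.trans hcon)
  rw [he] at h4
  refine hx (sub_eq_zero.1 ?_).symm
  have : x - metricProj A (metricProj B x) = (x - metricProj B x) +
    (metricProj B x - metricProj A (metricProj B x)) := by abel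
  rw [this, h3, h4]; abel

/-- The two points of best approximation pairs are translates of each other. -/
theorem proj_sub_proj_of_fixed (hA : IsNonemptyClosedConvex A) (hB : IsNonemptyClosedConvex B)
    {p p' : X} (hp : metricProj A (metricProj B p) = p)
    (hp' : metricProj A (metricProj B p') = p') :
    metricProj B p' - metricProj B p = p' - p := by
  have h1 := hA.proj_lipschitz (metricProj B p') (metricProj B p)
  rw [hp, hp'] at h1
  have h2 := hB.sub_proj_eq_of_norm_le h1
  rw [sub_eq_sub_iff_sub_eq_sub] at h2
  exact h2.symm

end BestApproxPair

/-! ### Local behaviour of the iteration for a polyhedron -/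

/-- Near a point `p` with projection `q`, and apart from an error of the order of a product of the
`1 - λₙ`, the iteration for a polyhedron preserves the component of the anchor in a subspace that
is orthogonal to the constraints active at `q`. -/
theorem exists_norm_starProjection_hlwb_sub_le {X : Type*} [NormedAddCommGroup X]
    [InnerProductSpace ℝ X] [FiniteDimensional ℝ X] {N : ℕ} [NeZero N] {lam : ℕ → ℝ}
    (hlam : ∀ n, 1 ≤ n → 0 ≤ lam n ∧ lam n ≤ 1) (hlim : Tendsto lam atTop (𝓝 0))
    (hsum : Tendsto (fun m => ∑ n ∈ Finset.range m, lam (n + 1)) atTop atTop)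
    (hvar : Summable fun n => |lam (n + 1) - lam (n + 1 + N)|)
    {u : Fin N → X} {c : Fin N → ℝ} {C : Fin N → Set X}
    (hCu : ∀ i, C i = {x | inner ℝ (u i) x ≤ c i}) (hC : ∀ i, IsNonemptyClosedConvex (C i)) (hne : (⋂ i, C i).Nonempty)
    (K : Submodule ℝ X) {p : X}
    (hK : ∀ i, inner ℝ (u i) (metricProj (⋂ i, C i) p) = c i → ∀ l ∈ K, inner ℝ (u i) l = 0)
    (R : ℝ) : ∃ δ > 0, ∃ m : ℕ, ∃ M : ℝ, ∀ n ≥ m, ∀ a x : X, ‖a - p‖ ≤ δ → ‖x‖ ≤ R →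
      ‖K.starProjection (hlwb lam C a x n - a)‖ ≤ M * ∏ j ∈ Finset.Ioc m n, (1 - lam j) := by
  have hI := IsNonemptyClosedConvex.iInter hC hne
  set q := metricProj (⋂ i, C i) p
  have hq : ∀ i, inner ℝ (u i) q ≤ c i := by
    intro i
    have := Set.mem_iInter.1 (hI.proj_mem p) i
    rw [hCu] at this
    exact this
  have hloc : ∀ᶠ y in 𝓝 q, ∀ i, inner ℝ (u i) q ≠ c i → y ∈ C i := by
    rw [eventually_all]
    intro i
    by_cases hi : inner ℝ (u i) q = c i
    · exact Eventually.of_forall fun y h => absurd hi h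
    · have hcont : Continuous fun y => inner ℝ (u i) y := by fun_prop
      filter_upwards [(hcont.tendsto q).eventually (gt_mem_nhds ((hq i).lt_of_ne hi))] with y hy _
      rw [hCu]
      exact hy.le
  obtain ⟨δ', hδ', hball⟩ := Metric.nhds_basis_closedBall.eventually_iff.1 hloc
  obtain ⟨m, hm⟩ := eventually_atTop.1 (uniform_tendsto_hlwb hlam hlim hsum hvar hC hne
    (max R (‖p‖ + δ' / 2)) (half_pos hδ'))
  -- Half of δ' pays for moving the anchor, half for the uniform convergence; the last constant
  -- bounds the distance from the m-th iterate to the anchor.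
  refine ⟨δ' / 2, half_pos hδ', m, δ' + ‖q - p‖ + δ' / 2, ?_⟩
  intro n hn a x ha hx
  have hnear : ∀ j ≥ m, ‖hlwb lam C a x j - q‖ ≤ δ' := by
    intro j hj
    have ha' : ‖a‖ ≤ ‖p‖ + δ' / 2 := by
      have := norm_le_norm_add_norm_sub' a p
      linarith
    have h1 := hm j hj a x (ha'.trans (le_max_right _ _)) (hx.trans (le_max_left _ _))
    have h2 := hI.proj_lipschitz a p
    have h3 := norm_sub_le_norm_sub_add_norm_sub (hlwb lam C a x j) (metricProj (⋂ i, C i) a) q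
    linarith
  have hstep : ∀ j ≥ m, K.starProjection (hlwb lam C a x (j + 1) - a) =
      (1 - lam (j + 1)) • K.starProjection (hlwb lam C a x j - a) := by
    intro j hj
    set i := Fin.ofNat N j
    set y := hlwb lam C a x j
    -- If constraint i is active at q, then C i is invariant under translation by K, so the residual
    -- is orthogonal to K. If it is inactive, y already lies in C i.
    have h1 : K.starProjection (y - metricProj (C i) y) = 0 := by
      by_cases hi : inner ℝ (u i) q = c i
      · rw [Submodule.starProjection_apply_eq_zero_iff, Submodule.mem_orthogonal']
        intro l hl
        have h2 : inner ℝ (u i) (metricProj (C i) y) ≤ c i := by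
          have := (hC i).proj_mem y
          rw [hCu] at this ⊢
          exact this
        have h3 := hK i hi l hl
        refine (hC i).inner_sub_proj_eq_zero y ?_ ?_
        · rw [hCu] at h2 ⊢
          simpa [inner_add_right, h3] using h2
        · rw [hCu] at h2 ⊢
          simpa [inner_sub_right, h3] using h2
      · rw [(hC i).proj_of_mem (hball (mem_closedBall_iff_norm.2 (hnear j hj)) i hi), sub_self,
          map_zero]
    have e : hlwb lam C a x (j + 1) - a =
        (1 - lam (j + 1)) • ((y - a) - (y - metricProj (C i) y)) := by
      simp only [hlwb, i, y]; module
    rw [e, map_smul, map_sub, h1, sub_zero]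
  induction n, hn using Nat.le_induction with
  | base =>
    simp only [Finset.Ioc_self, Finset.prod_empty, mul_one]
    refine (Submodule.norm_starProjection_apply_le _ _).trans ?_
    have e : hlwb lam C a x m - a = (hlwb lam C a x m - q) + (q - p) - (a - p) := by abel
    rw [e]
    refine (norm_sub_le _ _).trans ?_
    linarith [norm_add_le (hlwb lam C a x m - q) (q - p), hnear m le_rfl]
  | succ n hn ih =>
    have h1 := (hlam (n + 1) (by omega)).2
    rw [hstep n hn, norm_smul, Real.norm_of_nonneg (by linarith),
      ← Finset.insert_Ioc_right_eq_Ioc_add_one (by omega), Finset.prod_insert (by simp)]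
    calc _ ≤ (1 - lam (n + 1)) * _ := mul_le_mul_of_nonneg_left ih (by linarith)
      _ = _ := by ring

/-! ### Asymptotic iteration of nonexpansive maps -/

theorem isClosed_fixedPoints_of_nonexpansive {X : Type*} [NormedAddCommGroup X] {T : X → X}
    (hT : ∀ x y, ‖T x - T y‖ ≤ ‖x - y‖) :
    IsClosed {x | T x = x} := by
  have hc : Continuous T := (LipschitzWith.of_dist_le_mul (K := 1) fun x y => by
    simpa [dist_eq_norm] using hT x y).continuous
  exact isClosed_eq hc continuous_id

section AsymptoticIteration

variable {X : Type*} [NormedAddCommGroup X] [InnerProductSpace ℝ X] [FiniteDimensional ℝ X]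
  {T : X → X}

/-- A point close to a translate of a subspace is close to the base point if the component of the
difference in the subspace is small. -/
theorem norm_sub_le_of_starProjection {K : Submodule ℝ X} {y e p : X} {ε δ : ℝ} (he : e - p ∈ K)
    (hy : ‖y - e‖ ≤ ε) (hπ : ‖K.starProjection (y - p)‖ ≤ δ) : ‖y - p‖ ≤ δ + 2 * ε := by
  have h1 : y - p = K.starProjection (y - p) + (y - e) - K.starProjection (y - e) := by
    have h2 : K.starProjection (e - p) = e - p := Submodule.starProjection_eq_self_iff.2 he
    have h3 : K.starProjection (y - p) = K.starProjection (y - e) + (e - p) := by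
      rw [← h2, ← map_add, sub_add_sub_cancel]
    rw [h3]; abel
  rw [h1]
  refine (norm_sub_le _ _).trans ?_
  linarith [norm_add_le (K.starProjection (y - p)) (y - e),
    K.norm_starProjection_apply_le (y - e)]

/-- On a bounded set, a strictly quasi-nonexpansive map reduces the distance to its fixed points,
also when it is slightly perturbed. -/
theorem exists_infDist_le_max (hT : ∀ x y, ‖T x - T y‖ ≤ ‖x - y‖) (hfix : ∃ p, T p = p)
    (hstrict : ∀ e x, T e = e → T x ≠ x → ‖T x - e‖ < ‖x - e‖) (r : ℝ) {ε : ℝ} (hε : 0 < ε) :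
    ∃ η > 0, ∀ x y, ‖x‖ ≤ r → ‖y - T x‖ ≤ η → Metric.infDist y {x | T x = x} ≤
      max ε (Metric.infDist x {x | T x = x} - η) := by
  have hcl := isClosed_fixedPoints_of_nonexpansive hT
  set E : Set X := {x | T x = x}
  have hE : E.Nonempty := hfix
  have hc : Continuous T := (LipschitzWith.of_dist_le_mul (K := 1) fun x y => by
    simpa [dist_eq_norm] using hT x y).continuous
  have hle : ∀ x, ∃ e ∈ E, Metric.infDist x E = ‖x - e‖ ∧ Metric.infDist (T x) E ≤ ‖T x - e‖ := by
    intro x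
    obtain ⟨e, he, hxe⟩ := hcl.exists_infDist_eq_dist hE x
    refine ⟨e, he, by rw [hxe, dist_eq_norm], ?_⟩
    rw [← dist_eq_norm]
    exact Metric.infDist_le_dist_of_mem he
  have hK : IsCompact (Metric.closedBall (0 : X) r ∩ {x | ε / 2 ≤ Metric.infDist x E}) :=
    (isCompact_closedBall _ _).inter_right
      (isClosed_le continuous_const (Metric.continuous_infDist_pt E))
  -- By compactness the strict decrease is at least some g > 0 wherever the distance to E is at
  -- least ε/2; half of g absorbs the perturbation.
  obtain ⟨g, hg0, hg⟩ := hK.exists_forall_le' (a := 0)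
    (f := fun x => Metric.infDist x E - Metric.infDist (T x) E)
    ((Metric.continuous_infDist_pt E).sub
      ((Metric.continuous_infDist_pt E).comp hc)).continuousOn (by
    rintro x ⟨-, hx⟩
    have hx : ε / 2 ≤ Metric.infDist x E := hx
    obtain ⟨e, he, h1, h2⟩ := hle x
    have hxE : T x ≠ x := by
      intro h
      rw [Metric.infDist_zero_of_mem (show x ∈ E from h)] at hx
      linarith
    have := hstrict e x he hxE
    linarith)
  refine ⟨min (ε / 2) (g / 2), by positivity, fun x y hx hy => ?_⟩
  have h1 : Metric.infDist y E ≤ Metric.infDist (T x) E + ‖y - T x‖ := by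
    rw [← dist_eq_norm]; exact Metric.infDist_le_infDist_add_dist
  by_cases h : ε / 2 ≤ Metric.infDist x E
  · have h2 := hg x ⟨mem_closedBall_zero_iff.2 hx, h⟩
    refine le_max_of_le_right ?_
    linarith [min_le_right (ε / 2) (g / 2)]
  · obtain ⟨e, he, h2, h3⟩ := hle x
    have h4 := hT x e
    rw [show T e = e from he] at h4
    refine le_max_of_le_left ?_
    linarith [min_le_left (ε / 2) (g / 2)]

theorem exists_min_of_nonempty {α : Type*} (c : α → ℕ) {S : Set α} (hS : S.Nonempty) :
    ∃ p ∈ S, ∀ p' ∈ S, c p ≤ c p' := by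
  obtain ⟨p, hp, h⟩ := (InvImage.wf c wellFounded_lt).has_min S hS
  exact ⟨p, hp, fun p' hp' => not_lt.1 (h p' hp')⟩

variable {R : ℕ → X → X} {c : X → ℕ}

theorem sum_range_le_of_tail {e : ℕ → ℝ} (he0 : ∀ k, 0 ≤ e k) (he : Summable e) {ε : ℝ} {m : ℕ}
    (h : ∑' k, e (k + m) < ε) (j : ℕ) : ∑ i ∈ Finset.range j, e (m + i) ≤ ε := by
  simp_rw [add_comm m]
  exact (((summable_nat_add_iff m).2 he).sum_le_tsum _ fun i _ => he0 _).trans h.le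

/-- An orbit of the maps `R k` started late enough at a suitable fixed point of their limit `T`
stays bounded. -/
theorem exists_bounded_orbit (hT : ∀ x y, ‖T x - T y‖ ≤ ‖x - y‖) (hfix : ∃ p, T p = p)
    (hstrict : ∀ e x, T e = e → T x ≠ x → ‖T x - e‖ < ‖x - e‖)
    (hRT : ∀ r : ℝ, ∀ ε > 0, ∀ᶠ k in atTop, ∀ x, ‖x‖ ≤ r → ‖R k x - T x‖ ≤ ε)
    (hloc : ∀ p, T p = p → ∃ K : Submodule ℝ X, ∃ δ > 0, ∃ e : ℕ → ℝ, Summable e ∧ (∀ k, 0 ≤ e k) ∧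
      (∀ᶠ k in atTop, ∀ x, ‖x - p‖ ≤ δ → ‖K.starProjection (R k x - x)‖ ≤ e k) ∧
      ∀ p', T p' = p' → ‖p' - p‖ ≤ δ → c p ≤ c p' → p' - p ∈ K) :
    ∃ (m : ℕ) (w : ℕ → X) (r : ℝ), (∀ j, w (j + 1) = R (m + j) (w j)) ∧ ∀ j, ‖w j‖ ≤ r := by
  obtain ⟨p, hp, hmin⟩ := exists_min_of_nonempty c (S := {x | T x = x}) hfix
  obtain ⟨K, δ, hδ, e, he, he0, hKR, hKE⟩ := hloc p hp
  have hcl := isClosed_fixedPoints_of_nonexpansive hT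
  set E : Set X := {x | T x = x}
  have hε : 0 < δ / 8 := by positivity
  obtain ⟨η, hη, hdist⟩ := exists_infDist_le_max hT hfix hstrict (‖p‖ + δ) hε
  obtain ⟨m, h1, h2, h3⟩ := ((hRT (‖p‖ + δ) (min η (δ / 8)) (by positivity)).and (hKR.and
    ((tendsto_sum_nat_add e).eventually (gt_mem_nhds hε)))).exists_forall_of_atTop.imp
      fun m hm => (⟨fun k hk => (hm k hk).1, fun k hk => (hm k hk).2.1, (hm m le_rfl).2.2⟩ :
        (∀ k ≥ m, ∀ x, ‖x‖ ≤ ‖p‖ + δ → ‖R k x - T x‖ ≤ min η (δ / 8)) ∧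
        (∀ k ≥ m, ∀ x, ‖x - p‖ ≤ δ → ‖K.starProjection (R k x - x)‖ ≤ e k) ∧
        ∑' i, e (i + m) < δ / 8)
  let w : ℕ → X := fun j => Nat.rec p (fun j x => R (m + j) x) j
  have hw : ∀ j, w (j + 1) = R (m + j) (w j) := fun _ => rfl
  -- The invariant closes up: by minimality of c p, the nearest fixed point lies in p + K, so the
  -- distance to p is at most δ/8 from the motion in K plus 2 · δ/8 from the distance to E.
  have key : ∀ j, ‖w j - p‖ ≤ δ / 2 ∧ Metric.infDist (w j) E ≤ δ / 8 ∧
      ‖K.starProjection (w j - p)‖ ≤ ∑ i ∈ Finset.range j, e (m + i) := by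
    intro j
    induction j with
    | zero =>
      have : w 0 = p := rfl
      simp only [this, sub_self, norm_zero, map_zero, Finset.range_zero, Finset.sum_empty, le_refl,
        and_true]
      exact ⟨by positivity, (Metric.infDist_zero_of_mem hp).trans_le hε.le⟩
    | succ j ih =>
      obtain ⟨i1, i2, i3⟩ := ih
      rw [hw]
      set x := w j
      set y := R (m + j) x
      have hx : ‖x‖ ≤ ‖p‖ + δ := by
        have := norm_le_norm_add_norm_sub' x p
        linarith
      have hyT := h1 (m + j) (by omega) x hx
      have hD : Metric.infDist y E ≤ δ / 8 := by
        refine (hdist x y hx (hyT.trans (min_le_left _ _))).trans (max_le le_rfl ?_)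
        linarith
      have hπ : ‖K.starProjection (y - p)‖ ≤ ∑ i ∈ Finset.range (j + 1), e (m + i) := by
        rw [Finset.sum_range_succ, ← sub_add_sub_cancel y x p, map_add]
        refine (norm_add_le _ _).trans ?_
        linarith [h2 (m + j) (by omega) x (by linarith)]
      refine ⟨?_, hD, hπ⟩
      obtain ⟨f, hf, hyf⟩ := hcl.exists_infDist_eq_dist hfix y
      rw [dist_eq_norm] at hyf
      have hyf' : ‖y - f‖ ≤ δ / 8 := hyf ▸ hD
      have hyp : ‖y - p‖ ≤ δ / 2 + δ / 8 := by
        have h4 := norm_sub_le_norm_sub_add_norm_sub y (T x) p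
        have h5 := hT x p
        rw [show T p = p from hp] at h5
        linarith [min_le_right η (δ / 8)]
      have hfp : ‖f - p‖ ≤ δ := by
        have h4 := norm_sub_le_norm_sub_add_norm_sub f y p
        rw [norm_sub_rev f y] at h4
        linarith
      have := norm_sub_le_of_starProjection (hKE f hf hfp (hmin f hf)) hyf'
        (hπ.trans (sum_range_le_of_tail he0 he h3 _))
      linarith
  refine ⟨m, w, ‖p‖ + δ, hw, fun j => ?_⟩
  have := norm_le_norm_add_norm_sub' (w j) p
  linarith [(key j).1]

/-- Orbits of nonexpansive maps `R k` converging to a strictly quasi-nonexpansive map `T` converge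
to a fixed point of `T` if near each fixed point `p` the maps `R k` move points summably little in
the directions of the stratum of `p`, the strata being the level sets of a function `c` which is
locally maximal at each point. -/
theorem exists_tendsto_of_asymptotic_iteration (hR : ∀ k x y, ‖R k x - R k y‖ ≤ ‖x - y‖)
    (hT : ∀ x y, ‖T x - T y‖ ≤ ‖x - y‖) (hfix : ∃ p, T p = p)
    (hstrict : ∀ e x, T e = e → T x ≠ x → ‖T x - e‖ < ‖x - e‖)
    (hRT : ∀ r : ℝ, ∀ ε > 0, ∀ᶠ k in atTop, ∀ x, ‖x‖ ≤ r → ‖R k x - T x‖ ≤ ε)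
    (hloc : ∀ p, T p = p → ∃ K : Submodule ℝ X, ∃ δ > 0, ∃ e : ℕ → ℝ, Summable e ∧ (∀ k, 0 ≤ e k) ∧
      (∀ᶠ k in atTop, ∀ x, ‖x - p‖ ≤ δ → ‖K.starProjection (R k x - x)‖ ≤ e k) ∧
      ∀ p', T p' = p' → ‖p' - p‖ ≤ δ → c p ≤ c p' → p' - p ∈ K)
    {z : ℕ → X} (hz : ∀ k, z (k + 1) = R k (z k)) : ∃ p, T p = p ∧ Tendsto z atTop (𝓝 p) := by
  obtain ⟨r, hr⟩ : ∃ r, ∀ᶠ k in atTop, ‖z k‖ ≤ r := by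
    -- One bounded orbit suffices: two orbits of the same nonexpansive maps never move apart.
    obtain ⟨m, w, r, hw, hwr⟩ := exists_bounded_orbit hT hfix hstrict hRT hloc
    have h1 : ∀ j, ‖z (m + j) - w j‖ ≤ ‖z m - w 0‖ := by
      intro j
      induction j with
      | zero => rfl
      | succ j ih =>
        rw [← add_assoc, hz, hw]
        exact (hR _ _ _).trans ih
    refine ⟨r + ‖z m - w 0‖, eventually_atTop.2 ⟨m, fun k hk => ?_⟩⟩
    obtain ⟨j, rfl⟩ := Nat.exists_eq_add_of_le hk
    have := norm_le_norm_add_norm_sub' (z (m + j)) (w j)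
    linarith [h1 j, hwr j]
  have hcl := isClosed_fixedPoints_of_nonexpansive hT
  set E : Set X := {x | T x = x}
  have hD : Tendsto (fun k => Metric.infDist (z k) E) atTop (𝓝 0) := by
    refine Metric.tendsto_atTop.2 fun ε hε => ?_
    obtain ⟨η, hη, hdist⟩ := exists_infDist_le_max hT hfix hstrict r (half_pos hε)
    obtain ⟨m, hm⟩ := (hr.and (hRT r η hη)).exists_forall_of_atTop
    have h1 : ∀ j, Metric.infDist (z (m + j)) E ≤
        max (ε / 2) (Metric.infDist (z m) E - j * η) := by
      intro j
      induction j with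
      | zero => simp
      | succ j ih =>
        have h2 := hm (m + j) (by omega)
        have h3 := hdist (z (m + j)) (z (m + j + 1)) h2.1 (by rw [hz]; exact h2.2 _ h2.1)
        rw [← add_assoc]
        refine h3.trans (max_le (le_max_left _ _) ?_)
        rcases le_max_iff.1 ih with h | h
        · exact le_max_of_le_left (by linarith)
        · refine le_max_of_le_right ?_
          push_cast
          linarith
    obtain ⟨J, hJ⟩ := exists_nat_gt (Metric.infDist (z m) E / η)
    refine ⟨m + J, fun n hn => ?_⟩
    obtain ⟨j, rfl⟩ := Nat.exists_eq_add_of_le ((Nat.le_add_right m J).trans hn)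
    have hjJ : (J : ℝ) ≤ j := by exact_mod_cast (by omega : J ≤ j)
    have h2 : Metric.infDist (z m) E ≤ j * η := ((div_lt_iff₀ hη).1 hJ).le.trans (by gcongr)
    rw [Real.dist_eq, sub_zero, abs_of_nonneg Metric.infDist_nonneg]
    refine (h1 j).trans_lt (max_lt (by linarith) (by linarith))
  have hstep : ∀ ε > 0, ∀ᶠ k in atTop, ‖z (k + 1) - z k‖ ≤ ε := by
    intro ε hε
    filter_upwards [hr, hRT r (ε / 2) (by positivity),
      hD.eventually (gt_mem_nhds (by positivity : 0 < ε / 4))] with k h1 h2 h3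
    obtain ⟨f, hf, hzf⟩ := hcl.exists_infDist_eq_dist hfix (z k)
    rw [hzf, dist_eq_norm] at h3
    have h4 := h2 _ h1
    have h5 := hT (z k) f
    rw [show T f = f from hf] at h5
    have h6 : z (k + 1) - z k = (R k (z k) - T (z k)) + (T (z k) - f) + (f - z k) := by
      rw [hz]; abel
    rw [h6]
    refine norm_add₃_le.trans ?_
    rw [norm_sub_rev f]
    linarith
  have hSne : {y | MapClusterPt y atTop z}.Nonempty := by
    obtain ⟨y, -, hy⟩ := (isCompact_closedBall (0 : X) r).exists_mapClusterPt_of_frequently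
      (hr.mono fun k hk => mem_closedBall_zero_iff.2 hk).frequently
    exact ⟨y, hy⟩
  have hSE : ∀ y, MapClusterPt y atTop z → T y = y := by
    intro y hy
    have h1 : Metric.infDist y E = 0 := (hy.continuousAt_comp
      (Metric.continuous_infDist_pt E).continuousAt).eq_of_tendsto hD
    exact (hcl.mem_iff_infDist_zero hfix).2 h1
  obtain ⟨p, hp, hmin⟩ := exists_min_of_nonempty c hSne
  have hp : MapClusterPt p atTop z := hp
  obtain ⟨K, δ, hδ, e, he, he0, hKR, hKE⟩ := hloc p (hSE p hp)
  -- Otherwise there is a cluster point within δ of p and outside p + K, against the minimality of c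
  -- p.
  have hnormal : ∀ ε > 0, ∀ᶠ k in atTop, ‖z k - p‖ ≤ δ →
      ‖(z k - p) - K.starProjection (z k - p)‖ ≤ ε := by
    intro ε hε
    by_contra hcon
    have hcomp : IsCompact (Metric.closedBall p δ ∩
        {y | ε ≤ ‖(y - p) - K.starProjection (y - p)‖}) :=
      (isCompact_closedBall p δ).inter_right (isClosed_le continuous_const (by fun_prop))
    obtain ⟨y, ⟨hy1, hy2⟩, hyc⟩ := hcomp.exists_mapClusterPt_of_frequently (f := z) (l := atTop)
      ((not_eventually.1 hcon).mono fun k hk => by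
        push Not at hk
        exact ⟨mem_closedBall_iff_norm.2 hk.1, hk.2.le⟩)
    have hyK := hKE y (hSE y hyc) (mem_closedBall_iff_norm.1 hy1) (hmin y hyc)
    have hy2 : ε ≤ ‖(y - p) - K.starProjection (y - p)‖ := hy2
    rw [Submodule.starProjection_eq_self_iff.2 hyK, sub_self, norm_zero] at hy2
    linarith
  refine ⟨p, hSE p hp, Metric.tendsto_atTop.2 fun ε₀ hε₀ => ?_⟩
  obtain ⟨ε, hε, hεδ, hεε⟩ : ∃ ε > 0, 4 * ε ≤ δ ∧ 4 * ε ≤ ε₀ :=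
    ⟨min δ ε₀ / 4, by positivity, by linarith [min_le_left δ ε₀], by linarith [min_le_right δ ε₀]⟩
  obtain ⟨m, hm⟩ := ((hstep ε hε).and ((hnormal ε hε).and (hKR.and
    ((tendsto_sum_nat_add e).eventually (gt_mem_nhds hε))))).exists_forall_of_atTop
  obtain ⟨k₀, hk₀, hzk₀⟩ := ((hp.frequently (Metric.ball_mem_nhds p hε)).and_eventually
    (eventually_ge_atTop m)).exists.imp fun k hk => And.intro hk.2 (mem_ball_iff_norm.1 hk.1)
  have htail := sum_range_le_of_tail he0 he (hm k₀ hk₀).2.2.2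
  -- The 3ε consists of ε at the start, ε for the summable motion in K, and ε for the normal
  -- component. One step adds at most ε, and 4ε ≤ δ keeps the local estimates available.
  have key : ∀ j, ‖z (k₀ + j) - p‖ ≤ 3 * ε ∧
      ‖K.starProjection (z (k₀ + j) - p)‖ ≤ ε + ∑ i ∈ Finset.range j, e (k₀ + i) := by
    intro j
    induction j with
    | zero =>
      rw [add_zero, Finset.range_zero, Finset.sum_empty, add_zero]
      exact ⟨by linarith, (K.norm_starProjection_apply_le _).trans hzk₀.le⟩
    | succ j ih =>
      have h1 := hm (k₀ + j) (by omega)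
      have h2 := hm (k₀ + j + 1) (by omega)
      have hπ : ‖K.starProjection (z (k₀ + j + 1) - p)‖ ≤
          ε + ∑ i ∈ Finset.range (j + 1), e (k₀ + i) := by
        rw [Finset.sum_range_succ, ← sub_add_sub_cancel _ (z (k₀ + j)) p, map_add]
        refine (norm_add_le _ _).trans ?_
        have := h1.2.2.1 (z (k₀ + j)) (by linarith [ih.1])
        rw [← hz] at this
        linarith [ih.2]
      refine ⟨?_, hπ⟩
      rw [← add_assoc]
      have h3 : ‖z (k₀ + j + 1) - p‖ ≤ δ := by
        have := norm_sub_le_norm_sub_add_norm_sub (z (k₀ + j + 1)) (z (k₀ + j)) p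
        linarith [ih.1, h1.1]
      have h4 := h2.2.1 h3
      have h5 := norm_add_le (K.starProjection (z (k₀ + j + 1) - p))
        ((z (k₀ + j + 1) - p) - K.starProjection (z (k₀ + j + 1) - p))
      rw [add_sub_cancel] at h5
      linarith [htail (j + 1)]
  refine ⟨k₀, fun n hn => ?_⟩
  obtain ⟨j, rfl⟩ := Nat.exists_eq_add_of_le hn
  rw [dist_eq_norm]
  linarith [(key j).1]

end AsymptoticIteration

/-! ### Half-spaces, active constraints and the main theorem -/

theorem exists_eq_halfSpace_of_isClosedHalfSpace_or_univ {X : Type*}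
    [NormedAddCommGroup X] [InnerProductSpace ℝ X] {C : Set X} (h : IsClosedHalfSpace C ∨ C = Set.univ) :
    ∃ (u : X) (c : ℝ), C = {x | inner ℝ u x ≤ c} := by
  rcases h with ⟨u, c, -, h⟩ | h
  · exact ⟨u, c, h⟩
  -- The whole space gets normal 0: the constraint is active everywhere but restricts no direction
  -- of K.
  · exact ⟨0, 0, by simp [h]⟩

theorem isNonemptyClosedConvex_of_eq_halfSpace {X : Type*} [NormedAddCommGroup X]
    [InnerProductSpace ℝ X] {C : Set X} {u : X} {c : ℝ} (hC : C = {x | inner ℝ u x ≤ c})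
    (hne : C.Nonempty) : IsNonemptyClosedConvex C := by
  refine ⟨hne, ?_, ?_⟩
  · rw [hC]
    exact isClosed_le (by fun_prop) continuous_const
  · rw [hC]
    exact convex_halfSpace_le (innerSL ℝ u).toLinearMap.isLinear c

/-- The products of the `1 - λₙ` over the sweeps, from any index on, are summable. -/
theorem summable_prod_of_iSup_tsum_lt_top {lam : ℕ → ℝ}
    (hlam : ∀ n, 1 ≤ n → 0 ≤ lam n ∧ lam n ≤ 1) {nk : ℕ → ℕ} (hmono : Monotone nk)
    (hlim : Tendsto nk atTop atTop)
    (h : (⨆ k₀ : ℕ, ∑' k : Set.Ioi k₀,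
        ENNReal.ofReal (∏ n ∈ Finset.Ioc (nk k₀) (nk k), (1 - lam n))) < ⊤) (m : ℕ) :
    Summable fun k => ∏ n ∈ Finset.Ioc m (nk k), (1 - lam n) := by
  obtain ⟨k₀, hk₀⟩ := (hlim.eventually_ge_atTop m).exists
  have h1 := ENNReal.summable_toReal ((le_iSup (fun k₀ : ℕ => ∑' k : Set.Ioi k₀,
    ENNReal.ofReal (∏ n ∈ Finset.Ioc (nk k₀) (nk k), (1 - lam n))) k₀).trans_lt h).ne
  have hinj : Function.Injective fun j : ℕ => (⟨j + (k₀ + 1), by simp; omega⟩ : Set.Ioi k₀) :=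
    fun i j hij => by simpa using hij
  -- The product from m on is this fixed factor times the product from `nk k₀` on.
  have h2 := (h1.comp_injective hinj).mul_left (∏ n ∈ Finset.Ioc m (nk k₀), (1 - lam n))
  rw [← summable_nat_add_iff (k₀ + 1)]
  refine h2.congr fun j => ?_
  simp only [Function.comp]
  rw [ENNReal.toReal_ofReal, Finset.prod_Ioc_consecutive _ hk₀ (hmono (by omega))]
  refine Finset.prod_nonneg fun n hn => ?_
  rw [Finset.mem_Ioc] at hn
  linarith [(hlam n (by omega)).2]

/-- On a set `E` along which the maps `g i` act as translations, a point near `p` with at least as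
many active constraints `⟪w i, g i p⟫ = c i` as `p` differs from `p` by a vector orthogonal to the
constraints active at `p`. -/
theorem exists_ball_forall_inner_sub_eq_zero {ι X : Type*} [Finite ι] [NormedAddCommGroup X]
    [InnerProductSpace ℝ X] {E : Set X} (w : ι → X) (c : ι → ℝ) (g : ι → X → X)
    (hg : ∀ i, Continuous (g i)) (hgE : ∀ i, ∀ p ∈ E, ∀ p' ∈ E, g i p' - g i p = p' - p) {p : X}
    (hp : p ∈ E) : ∃ δ > 0, ∀ p' ∈ E, ‖p' - p‖ ≤ δ →
      {i | inner ℝ (w i) (g i p) = c i}.ncard ≤ {i | inner ℝ (w i) (g i p') = c i}.ncard →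
      ∀ i, inner ℝ (w i) (g i p) = c i → inner ℝ (w i) (p' - p) = 0 := by
  have hev : ∀ᶠ p' in 𝓝 p, ∀ i, inner ℝ (w i) (g i p) ≠ c i → inner ℝ (w i) (g i p') ≠ c i := by
    rw [eventually_all]
    intro i
    by_cases hi : inner ℝ (w i) (g i p) = c i
    · exact Eventually.of_forall fun _ h => absurd hi h
    · have hcont : Continuous fun x => inner ℝ (w i) (g i x) := continuous_const.inner (hg i)
      filter_upwards [(hcont.tendsto p).eventually_ne hi] with x hx _ using hx
  obtain ⟨δ, hδ, hball⟩ := Metric.nhds_basis_closedBall.eventually_iff.1 hev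
  refine ⟨δ, hδ, fun p' hp' hpp hcard i hi => ?_⟩
  -- Near p no constraint becomes active, so the cardinality bound forces the two active sets to
  -- coincide.
  have hsub : {i | inner ℝ (w i) (g i p') = c i} ⊆ {i | inner ℝ (w i) (g i p) = c i} := by
    intro j hj
    by_contra hcon
    exact hball (mem_closedBall_iff_norm.2 hpp) j hcon hj
  have hi' : i ∈ {i | inner ℝ (w i) (g i p') = c i} :=
    Set.eq_of_subset_of_ncard_le hsub hcard ▸ hi
  have hi' : inner ℝ (w i) (g i p') = c i := hi'
  rw [← hgE i p hp p' hp', inner_sub_right, hi, hi', sub_self]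

theorem theorem1 {d N : ℕ} [NeZero N]
    (A B : Fin N → Set (EuclideanSpace ℝ (Fin d)))
    (hA : ∀ i, IsClosedHalfSpace (A i) ∨ A i = Set.univ)
    (hB : ∀ i, IsClosedHalfSpace (B i) ∨ B i = Set.univ)
    (hAne : (⋂ i, A i).Nonempty) (hBne : (⋂ i, B i).Nonempty)
    (lam : ℕ → ℝ)
    (hlam01 : ∀ n, 1 ≤ n → 0 ≤ lam n ∧ lam n ≤ 1)
    (hlam_lim : Tendsto lam atTop (𝓝 0))
    (hlam_sum : Tendsto (fun m => ∑ n ∈ Finset.Icc 1 m, lam n) atTop atTop)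
    (hlam_var : Summable fun n => |lam (n + 1) - lam (n + 1 + N)|)
    (nk : ℕ → ℕ) (hnk_mono : Monotone nk) (hnk_lim : Tendsto nk atTop atTop)
    (hnk_iter : (⨆ k₀ : ℕ, ∑' k : Set.Ioi k₀,
        ENNReal.ofReal (∏ n ∈ Finset.Ioc (nk k₀) (nk k), (1 - lam n))) < ⊤)
    (a' b' : ℕ → EuclideanSpace ℝ (Fin d))
    (haux : Bornology.IsBounded (Set.range fun k : ℕ => (a' (2 * k), b' (2 * k + 1))))
    (a b : ℕ → EuclideanSpace ℝ (Fin d))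
    (hrun : IsAlternatingHLWB lam nk A B a' b' a b) :
    ∃ p : EuclideanSpace ℝ (Fin d) × EuclideanSpace ℝ (Fin d),
      IsBestApproxPair (⋂ i, A i) (⋂ i, B i) p ∧
      Tendsto (fun k : ℕ => (a (2 * k), b (2 * k + 1))) atTop (𝓝 p) := by
  choose u α hu using fun i => exists_eq_halfSpace_of_isClosedHalfSpace_or_univ (hA i)
  choose v β hv using fun i => exists_eq_halfSpace_of_isClosedHalfSpace_or_univ (hB i)
  have hCA : ∀ i, IsNonemptyClosedConvex (A i) := fun i =>
    isNonemptyClosedConvex_of_eq_halfSpace (hu i) (hAne.mono (Set.iInter_subset _ i))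
  have hCB : ∀ i, IsNonemptyClosedConvex (B i) := fun i =>
    isNonemptyClosedConvex_of_eq_halfSpace (hv i) (hBne.mono (Set.iInter_subset _ i))
  have hIA := IsNonemptyClosedConvex.iInter hCA hAne
  have hIB := IsNonemptyClosedConvex.iInter hCB hBne
  have hsum : Tendsto (fun m => ∑ n ∈ Finset.range m, lam (n + 1)) atTop atTop := by
    refine hlam_sum.congr fun m => ?_
    rw [Finset.range_eq_Ico, Finset.sum_Ico_add' lam 0 m 1, zero_add]
    rfl
  obtain ⟨ρ, hρ⟩ := haux.exists_norm_le
  have hρa : ∀ k, ‖a' (2 * k)‖ ≤ ρ := fun k =>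
    (norm_fst_le (a' (2 * k), b' (2 * k + 1))).trans (hρ _ ⟨k, rfl⟩)
  have hρb : ∀ k, ‖b' (2 * k + 1)‖ ≤ ρ := fun k =>
    (norm_snd_le (a' (2 * k), b' (2 * k + 1))).trans (hρ _ ⟨k, rfl⟩)
  have hk0 : Tendsto (fun k : ℕ => 2 * k) atTop atTop :=
    tendsto_atTop_mono (fun k => by omega : ∀ k : ℕ, k ≤ 2 * k) tendsto_id
  have hk1 : Tendsto (fun k : ℕ => 2 * k + 1) atTop atTop :=
    tendsto_atTop_mono (fun k => by omega : ∀ k : ℕ, k ≤ 2 * k + 1) tendsto_id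
  set QB : ℕ → EuclideanSpace ℝ (Fin d) → EuclideanSpace ℝ (Fin d) :=
    fun k x => hlwb lam B x (a' (2 * k)) (nk (2 * k))
  set QA : ℕ → EuclideanSpace ℝ (Fin d) → EuclideanSpace ℝ (Fin d) :=
    fun k x => hlwb lam A x (b' (2 * k + 1)) (nk (2 * k + 1))
  set PA := metricProj (⋂ i, A i)
  set PB := metricProj (⋂ i, B i)
  have hQB : ∀ r : ℝ, ∀ ε > 0, ∀ᶠ k in atTop, ∀ x, ‖x‖ ≤ r → ‖QB k x - PB x‖ ≤ ε := by
    intro r ε hε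
    filter_upwards [(hnk_lim.comp hk0).eventually (uniform_tendsto_hlwb hlam01 hlam_lim hsum
      hlam_var hCB hBne (max r ρ) hε)] with k hk x hx
    exact hk x _ (hx.trans (le_max_left _ _)) ((hρa k).trans (le_max_right _ _))
  have hQA : ∀ r : ℝ, ∀ ε > 0, ∀ᶠ k in atTop, ∀ x, ‖x‖ ≤ r → ‖QA k x - PA x‖ ≤ ε := by
    intro r ε hε
    filter_upwards [(hnk_lim.comp hk1).eventually (uniform_tendsto_hlwb hlam01 hlam_lim hsum
      hlam_var hCA hAne (max r ρ) hε)] with k hk x hx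
    exact hk x _ (hx.trans (le_max_left _ _)) ((hρb k).trans (le_max_right _ _))
  have hQBlip : ∀ k x y, ‖QB k x - QB k y‖ ≤ ‖x - y‖ := fun k x y =>
    hlwb_sub_hlwb_le hlam01 hCB le_rfl (by simp) _
  have hQAlip : ∀ k x y, ‖QA k x - QA k y‖ ≤ ‖x - y‖ := fun k x y =>
    hlwb_sub_hlwb_le hlam01 hCA le_rfl (by simp) _
  have hfix : ∃ p, PA (PB p) = p := by
    have h1 := hAne
    have h2 := hBne
    simp only [hu, hv] at h1 h2
    obtain ⟨p, hp⟩ := exists_isBestApproxPair_of_polyhedra u α v β h1 h2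
    simp only [← hu, ← hv] at hp
    obtain ⟨h3, h4⟩ := hp.proj_eq hIA hIB
    exact ⟨p.1, by rw [show PB p.1 = p.2 from h3]; exact h4⟩
  have hRT : ∀ r : ℝ, ∀ ε > 0, ∀ᶠ k in atTop, ∀ x, ‖x‖ ≤ r →
      ‖QA k (QB k x) - PA (PB x)‖ ≤ ε := by
    intro r ε hε
    filter_upwards [hQB r (ε / 2) (by positivity),
      hQA (ε / 2 + (r + ‖PB 0‖)) (ε / 2) (by positivity)] with k h1 h2 x hx
    have h3 := h1 x hx
    have h4 : ‖PB x‖ ≤ r + ‖PB 0‖ := by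
      have h5 := hIB.proj_lipschitz x 0
      rw [sub_zero] at h5
      have h6 := norm_le_norm_add_norm_sub' (PB x) (PB 0)
      linarith [show ‖PB x - PB 0‖ ≤ ‖x‖ from h5]
    have h5 := h2 (QB k x) (by linarith [norm_le_norm_add_norm_sub' (QB k x) (PB x)])
    have h6 : ‖PA (QB k x) - PA (PB x)‖ ≤ ‖QB k x - PB x‖ := hIA.proj_lipschitz _ _
    linarith [norm_sub_le_norm_sub_add_norm_sub (QA k (QB k x)) (PA (QB k x)) (PA (PB x))]
  set w : Fin N ⊕ Fin N → EuclideanSpace ℝ (Fin d) := Sum.elim u v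
  set γ : Fin N ⊕ Fin N → ℝ := Sum.elim α β
  -- Constraints of A are tested at p, those of B at its partner P_B p; both points move by the same
  -- vector along Fix T.
  set g : Fin N ⊕ Fin N → EuclideanSpace ℝ (Fin d) → EuclideanSpace ℝ (Fin d) :=
    Sum.elim (fun _ => id) (fun _ => PB)
  have hloc : ∀ p, PA (PB p) = p → ∃ K : Submodule ℝ (EuclideanSpace ℝ (Fin d)), ∃ δ > 0,
      ∃ e : ℕ → ℝ, Summable e ∧ (∀ k, 0 ≤ e k) ∧
      (∀ᶠ k in atTop, ∀ x, ‖x - p‖ ≤ δ → ‖K.starProjection (QA k (QB k x) - x)‖ ≤ e k) ∧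
      ∀ p', PA (PB p') = p' → ‖p' - p‖ ≤ δ →
        {i | inner ℝ (w i) (g i p) = γ i}.ncard ≤ {i | inner ℝ (w i) (g i p') = γ i}.ncard →
        p' - p ∈ K := by
    intro p hp
    let K : Submodule ℝ (EuclideanSpace ℝ (Fin d)) :=
      ⨅ i, ⨅ _ : inner ℝ (w i) (g i p) = γ i, (innerSL ℝ (w i)).ker
    have hK : ∀ l, l ∈ K ↔ ∀ i, inner ℝ (w i) (g i p) = γ i → inner ℝ (w i) l = 0 := by
      intro l
      simp [K, Submodule.mem_iInf]
    obtain ⟨δ₀, hδ₀, hstrat⟩ := exists_ball_forall_inner_sub_eq_zero (E := {x | PA (PB x) = x})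
      w γ g (by
        rintro (i | i)
        · exact continuous_id
        · exact hIB.continuous_proj) (by
        rintro (i | i) x hx y hy
        · rfl
        · exact proj_sub_proj_of_fixed hIA hIB hx hy) hp
    obtain ⟨δB, hδB, mB, MB, hMB⟩ := exists_norm_starProjection_hlwb_sub_le hlam01 hlam_lim hsum
      hlam_var hv hCB hBne K (p := p) (fun i hi l hl => (hK l).1 hl (Sum.inr i) hi) ρ
    -- The sweep over A starts from an anchor near P_B p, whose projection on A is p again, so the
    -- same K serves both sweeps.
    obtain ⟨δA, hδA, mA, MA, hMA⟩ := exists_norm_starProjection_hlwb_sub_le hlam01 hlam_lim hsum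
      hlam_var hu hCA hAne K (p := PB p)
      (fun i hi l hl => (hK l).1 hl (Sum.inl i) (by
        rw [show metricProj (⋂ i, A i) (PB p) = p from hp] at hi; exact hi)) ρ
    have hsB : Summable fun k => |MB| * ∏ n ∈ Finset.Ioc mB (nk (2 * k)), (1 - lam n) :=
      ((summable_prod_of_iSup_tsum_lt_top hlam01 hnk_mono hnk_lim hnk_iter mB).comp_injective
        (i := fun k => 2 * k) fun i j hij => by simpa using hij).mul_left _
    have hsA : Summable fun k => |MA| * ∏ n ∈ Finset.Ioc mA (nk (2 * k + 1)), (1 - lam n) :=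
      ((summable_prod_of_iSup_tsum_lt_top hlam01 hnk_mono hnk_lim hnk_iter mA).comp_injective
        (i := fun k => 2 * k + 1) fun i j hij => by simpa using hij).mul_left _
    have hprod : ∀ m n, 0 ≤ ∏ j ∈ Finset.Ioc m n, (1 - lam j) := fun m n =>
      Finset.prod_nonneg fun j hj => by
        rw [Finset.mem_Ioc] at hj
        linarith [(hlam01 j (by omega)).2]
    refine ⟨K, min δ₀ (min δB (δA / 2)), by positivity, _, hsA.add hsB,
      fun k => add_nonneg (mul_nonneg (abs_nonneg _) (hprod _ _))
        (mul_nonneg (abs_nonneg _) (hprod _ _)), ?_, ?_⟩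
    · filter_upwards [hQB (‖p‖ + δB) (δA / 2) (by positivity),
        (hnk_lim.comp hk0).eventually_ge_atTop mB,
        (hnk_lim.comp hk1).eventually_ge_atTop mA] with k h1 h2 h3 x hx
      have hxB : ‖x - p‖ ≤ δB := hx.trans ((min_le_right _ _).trans (min_le_left _ _))
      have hxA : ‖x - p‖ ≤ δA / 2 := hx.trans ((min_le_right _ _).trans (min_le_right _ _))
      have h4 := h1 x (by linarith [norm_le_norm_add_norm_sub' x p])
      have h5 : ‖PB x - PB p‖ ≤ ‖x - p‖ := hIB.proj_lipschitz _ _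
      have h6 := hMB _ h2 x _ hxB (hρa k)
      have h7 := hMA _ h3 (QB k x) _
        (by linarith [norm_sub_le_norm_sub_add_norm_sub (QB k x) (PB x) (PB p)]) (hρb k)
      have h8 := mul_le_mul_of_nonneg_right (le_abs_self MB) (hprod mB (nk (2 * k)))
      have h9 := mul_le_mul_of_nonneg_right (le_abs_self MA) (hprod mA (nk (2 * k + 1)))
      rw [← sub_add_sub_cancel (QA k (QB k x)) (QB k x) x, map_add]
      exact (norm_add_le _ _).trans (add_le_add (h7.trans h9) (h6.trans h8))
    · intro p' hp' hpp hc
      exact (hK _).2 (hstrat p' hp' (hpp.trans (min_le_left _ _)) hc)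
  have hz : ∀ k, a (2 * (k + 1)) = QA k (QB k (a (2 * k))) := by
    intro k
    have h1 : b (2 * k + 1) = QB k (a (2 * k)) := hrun.1 (2 * k) (even_two_mul k)
    have h2 : a (2 * k + 1 + 1) = QA k (b (2 * k + 1)) := hrun.2 (2 * k + 1) (odd_two_mul_add_one k)
    rw [← h1, ← h2]; rfl
  obtain ⟨p, hp, hlim⟩ := exists_tendsto_of_asymptotic_iteration
    (T := fun x => PA (PB x)) (R := fun k x => QA k (QB k x))
    (c := fun p => {i | inner ℝ (w i) (g i p) = γ i}.ncard) (z := fun k => a (2 * k))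
    (fun k x y => (hQAlip _ _ _).trans (hQBlip _ _ _)) (altProj_lipschitz hIA hIB) hfix
    (fun e x he hx => altProj_sub_lt hIA hIB he hx) hRT hloc hz
  refine ⟨(p, PB p), isBestApproxPair_of_fixed hIA hIB hp, hlim.prodMk_nhds ?_⟩
  refine Metric.tendsto_atTop.2 fun ε hε => ?_
  have h1 : ∀ᶠ k in atTop, ‖a (2 * k)‖ ≤ ‖p‖ + 1 :=
    (hlim.norm.eventually (gt_mem_nhds (lt_add_one ‖p‖))).mono fun k hk => hk.le
  obtain ⟨m, hm⟩ := ((h1.and (hQB (‖p‖ + 1) (ε / 2) (by positivity))).and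
    (Metric.tendsto_nhds.1 hlim (ε / 2) (by positivity))).exists_forall_of_atTop
  refine ⟨m, fun k hk => ?_⟩
  obtain ⟨⟨h2, h3⟩, h4⟩ := hm k hk
  have h5 : b (2 * k + 1) = QB k (a (2 * k)) := hrun.1 (2 * k) (even_two_mul k)
  have h6 : ‖PB (a (2 * k)) - PB p‖ ≤ ‖a (2 * k) - p‖ := hIB.proj_lipschitz _ _
  rw [dist_eq_norm] at h4 ⊢
  rw [h5]
  linarith [h3 _ h2, norm_sub_le_norm_sub_add_norm_sub (QB k (a (2 * k))) (PB (a (2 * k))) (PB p)]
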